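/- Let $A$ be a finite dimensional algebra over a field $K$; all modules are finite dimensional right $A$-modules, and $D=\operatorname{Hom}_K(-,K)$. For a module $M$ with minimal injective resolution $0\to M\to I_0\to I_1\to\cdots$, the dominant dimension $\operatorname{domdim}(M)$ is the supremum of all $n\ge 0$ such that $I_0,\dots,I_{n-1}$ are projective, and the codominant dimension is $\operatorname{codomdim}(M)=\operatorname{domdim}(D(M))$. Here $\Omega$ is the syzygy (the kernel of a projective cover), $\Omega^{-1}$ is the cosyzygy (the cokernel of an injective hull), and $\tau=D\operatorname{Tr}$, $\tau^{-1}=\operatorname{Tr}D$ are the Auslander–Reiten translates, where $\operatorname{Tr}(M)$ is the cokernel of $\operatorname{Hom}_A(P_0,A)\to\operatorname{Hom}_A(P_1,A)$ for a minimal projective presentation $P_1\to P_0\to M\to 0$. The algebra $A$ is called gendo-symmetric if $\operatorname{domdim}(A_A)\ge 2$ and $D(Ae)\cong eA$ as $(eAe,A)$-bimodules, where $e$ is an idempotent such that $eA$ is a minimal faithful projective-injective right $A$-module. **Proposition.** Let $A$ be a gendo-symmetric algebra and $M$ an $A$-module. 1. If $\operatorname{codomdim}(M)\ge 2$, then $\tau(M)\cong\Omega^{2}(M)$.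 If every projective direct summand of $M$ is injective (for instance, if $M$ has no nonzero projective direct summand), then $$\operatorname{codomdim}(M)\ge 2\iff \tau(M)\cong\Omega^{2}(M).$$ 2. If $\operatorname{domdim}(M)\ge 2$, then $\tau^{-1}(M)\cong\Omega^{-2}(M)$. If every injective direct summand of $M$ is projective (for instance, if $M$ has no nonzero injective direct summand), then $$\operatorname{domdim}(M)\ge 2\iff \tau^{-1}(M)\cong\Omega^{-2}(M).$$ -/

import Mathlib

universe u

namespace GendoSymm

open MulOpposite

/-! ### Projective covers and injective hulls -/

section Covers

variable {R : Type u} [Ring R]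

/-- `f : P → M` is a projective cover: `P` is projective, `f` is onto, and its kernel is
superfluous. -/
structure IsProjectiveCover {P M : Type u} [AddCommGroup P] [Module R P] [AddCommGroup M]
    [Module R M] (f : P →ₗ[R] M) : Prop where
  projective : Module.Projective R P
  surjective : Function.Surjective f
  superfluous : ∀ N : Submodule R P, N ⊔ LinearMap.ker f = ⊤ → N = ⊤

/-- `f : M → I` is an injective hull: `I` is injective, `f` is one-to-one, and its image is
essential. -/
structure IsInjectiveHull {M I : Type u} [AddCommGroup M] [Module R M] [AddCommGroup I]
    [Module R I] (f : M →ₗ[R] I) : Prop where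
  injective : Module.Injective R I
  injective_map : Function.Injective f
  essential : ∀ N : Submodule R I, N ⊓ LinearMap.range f = ⊥ → N = ⊥

/-- A retract of an injective module is injective. -/
theorem injective_of_retract {I J : Type u} [AddCommGroup I] [Module R I] [AddCommGroup J]
    [Module R J] (i : J →ₗ[R] I) (p : I →ₗ[R] J) (hpi : ∀ x, p (i x) = x)
    (hI : Module.Injective R I) : Module.Injective R J where
  out X Y _ _ _ _ f hf g := by
    obtain ⟨h, hh⟩ := hI.out f hf (i ∘ₗ g)
    exact ⟨p ∘ₗ h, fun x => by simp [hh, hpi]⟩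

end Covers

/-! ### Finite dimensional modules -/

/-- A finite dimensional (left) module over the `K`-algebra `R`. Right `A`-modules are modules
over `Aᵐᵒᵖ`. -/
structure FDMod (K : Type u) (R : Type u) [Field K] [Ring R] [Algebra K R] where
  /-- the underlying type -/
  carrier : Type u
  [addCommGroup : AddCommGroup carrier]
  [moduleK : Module K carrier]
  [module : Module R carrier]
  [isScalarTower : IsScalarTower K R carrier]
  [finite : FiniteDimensional K carrier]

namespace FDMod

attribute [instance] FDMod.addCommGroup FDMod.moduleK FDMod.module FDMod.isScalarTower
  FDMod.finite

instance (K : Type u) (R : Type u) [Field K] [Ring R] [Algebra K R] :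
    CoeSort (FDMod K R) (Type u) := ⟨FDMod.carrier⟩

/-- Bundling a finite dimensional module. -/
abbrev of (K : Type u) (R : Type u) [Field K] [Ring R] [Algebra K R] (M : Type u)
    [AddCommGroup M] [Module K M] [Module R M] [IsScalarTower K R M] [FiniteDimensional K M] :
    FDMod K R := ⟨M⟩

instance finiteDimensional_submodule {K : Type u} {R : Type u} [Field K] [Ring R] [Algebra K R]
    {M : Type u} [AddCommGroup M] [Module K M] [Module R M] [IsScalarTower K R M]
    [FiniteDimensional K M] (N : Submodule R M) : FiniteDimensional K N :=
  inferInstanceAs (FiniteDimensional K (N.restrictScalars K))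

/-- The coinduced module `Hom_K(R, M)`, with `(r f)(s) = f(s r)`. -/
def Coind (K R M : Type u) [Field K] [Ring R] [Algebra K R] [AddCommGroup M] [Module K M] :
    Type u := R →ₗ[K] M

namespace Coind

variable (K R M : Type u) [Field K] [Ring R] [Algebra K R] [AddCommGroup M] [Module K M]

instance : AddCommGroup (Coind K R M) := inferInstanceAs (AddCommGroup (R →ₗ[K] M))

instance : Module K (Coind K R M) := inferInstanceAs (Module K (R →ₗ[K] M))

instance [FiniteDimensional K R] [FiniteDimensional K M] : FiniteDimensional K (Coind K R M) :=
  inferInstanceAs (FiniteDimensional K (R →ₗ[K] M))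

variable {K R M} in
/-- Evaluation of an element of the coinduced module. -/
def eval (f : Coind K R M) (s : R) : M := (show R →ₗ[K] M from f) s

instance : Module R (Coind K R M) where
  smul r f := (show R →ₗ[K] M from f) ∘ₗ LinearMap.mulRight K r
  one_smul f := LinearMap.ext fun s => congrArg f.eval (mul_one s)
  mul_smul r s f := LinearMap.ext fun t => congrArg f.eval (mul_assoc t r s).symm
  smul_zero _ := rfl
  smul_add _ _ _ := rfl
  add_smul r s f := LinearMap.ext fun t =>
    (congrArg f.eval (mul_add t r s)).trans (map_add (show R →ₗ[K] M from f) _ _)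
  zero_smul f := LinearMap.ext fun t =>
    (congrArg f.eval (mul_zero t)).trans (map_zero (show R →ₗ[K] M from f))

variable {K R M} in
theorem smul_eval (r : R) (f : Coind K R M) (s : R) : (r • f).eval s = f.eval (s * r) := rfl

instance : IsScalarTower K R (Coind K R M) := ⟨fun k r f => LinearMap.ext fun s =>
  (congrArg f.eval (mul_smul_comm k s r)).trans (map_smul (show R →ₗ[K] M from f) k _)⟩

/-- The embedding `M → Hom_K(R, M)` of an `R`-module `M`. -/
def unit [Module R M] [IsScalarTower K R M] : M →ₗ[R] Coind K R M where
  toFun m := ((LinearMap.toSpanSingleton R M m).restrictScalars K : R →ₗ[K] M)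
  map_add' x y := LinearMap.ext fun s => smul_add s x y
  map_smul' r x := LinearMap.ext fun s => (mul_smul s r x).symm

theorem unit_injective [Module R M] [IsScalarTower K R M] :
    Function.Injective (unit K R M) := fun x y h => by
  have h1 : (1 : R) • x = (1 : R) • y := congrArg (fun f : Coind K R M => f.eval 1) h
  simpa using h1

end Coind

section Resolutions

variable {K : Type u} {R : Type u} [Field K] [Ring R] [Algebra K R] [FiniteDimensional K R]

/-- Every finite dimensional module has a finite dimensional projective cover. -/
theorem exists_projectiveCover (M : FDMod K R) :
    ∃ (P : FDMod K R) (f : P →ₗ[R] M), IsProjectiveCover f := by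
  classical
  have hex : ∃ n : ℕ, ∃ (P : FDMod K R) (f : P →ₗ[R] M), Module.Projective R P ∧
      Function.Surjective f ∧ Module.finrank K P = n := by
    have : Module.Finite R M := Module.Finite.of_restrictScalars_finite K R M
    obtain ⟨k, f, hf⟩ := Module.Finite.exists_fin' R M
    exact ⟨_, of K R (Fin k → R), f, inferInstanceAs (Module.Projective R (Fin k → R)), hf, rfl⟩
  obtain ⟨P, f, hP, hf, hn⟩ := Nat.find_spec hex
  refine ⟨P, f, hP, hf, fun N hN => ?_⟩
  have hs : Function.Surjective (f ∘ₗ N.subtype) := by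
    intro m
    obtain ⟨p, rfl⟩ := hf m
    obtain ⟨x, hx, y, hy, rfl⟩ := Submodule.mem_sup.1 (hN ▸ Submodule.mem_top : p ∈ N ⊔ _)
    exact ⟨⟨x, hx⟩, by simp [LinearMap.mem_ker.1 hy]⟩
  obtain ⟨g₀, hg₀⟩ := Module.projective_lifting_property (f ∘ₗ N.subtype) f hs
  set g : P →ₗ[R] P := N.subtype ∘ₗ g₀ with hg
  have hfg : ∀ n x, f ((g ^ n) x) = f x := by
    intro n
    induction n with
    | zero => simp
    | succ n ih =>
      intro x
      rw [pow_succ, Module.End.mul_apply, ih]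
      exact LinearMap.congr_fun hg₀ x
  have : IsNoetherian R P := isNoetherian_of_tower K inferInstance
  have : IsArtinian R P := isArtinian_of_tower K inferInstance
  obtain ⟨n, hn1, hc⟩ := ((Filter.eventually_ge_atTop 1).and
    (LinearMap.eventually_isCompl_ker_pow_range_pow g)).exists
  set Q : Submodule R P := LinearMap.range (g ^ n)
  have hQ : Module.Projective R Q := by
    refine Module.Projective.of_split Q.subtype (Submodule.projectionOnto Q _ hc.symm) ?_
    ext x
    simp
  have hle := Nat.find_min' hex ⟨of K R Q, f ∘ₗ Q.subtype, hQ, fun m => by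
    obtain ⟨p, rfl⟩ := hf m
    exact ⟨⟨(g ^ n) p, p, rfl⟩, hfg n p⟩, rfl⟩
  rw [← hn] at hle
  have htop : Q.restrictScalars K = ⊤ :=
    Submodule.eq_top_of_finrank_eq (le_antisymm (Submodule.finrank_le _) hle)
  have hQtop : Q = ⊤ := by simpa using htop
  refine top_le_iff.1 (hQtop ▸ ?_)
  rintro _ ⟨x, rfl⟩
  obtain ⟨k, rfl⟩ : ∃ k, n = k + 1 := ⟨n - 1, by omega⟩
  rw [pow_succ', Module.End.mul_apply]
  exact (g₀ _).2

/-- Every finite dimensional module embeds into a finite dimensional injective module. -/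
theorem exists_injective (M : FDMod K R) :
    ∃ (I : FDMod K R) (f : M →ₗ[R] I), Module.Injective R I ∧ Function.Injective f := by
  refine ⟨{ carrier := Coind K R M }, Coind.unit K R M, ⟨fun X Y _ _ _ _ f hf g => ?_⟩,
    Coind.unit_injective K R M⟩
  let _ : Module K X := Module.compHom X (algebraMap K R)
  let _ : Module K Y := Module.compHom Y (algebraMap K R)
  have : IsScalarTower K R X := ⟨fun k r x => by
    change (k • r) • x = algebraMap K R k • r • x
    rw [Algebra.smul_def, mul_smul]⟩
  have : IsScalarTower K R Y := ⟨fun k r x => by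
    change (k • r) • x = algebraMap K R k • r • x
    rw [Algebra.smul_def, mul_smul]⟩
  obtain ⟨q, hq⟩ := (f.restrictScalars K).exists_leftInverse_of_injective
    (LinearMap.ker_eq_bot.2 hf)
  have hq' : ∀ x, q (f x) = x := fun x => LinearMap.congr_fun hq x
  change X →ₗ[R] Coind K R M at g
  let ev : X →ₗ[K] M :=
    { toFun := fun x => (g x).eval 1
      map_add' := fun x y => by rw [map_add]; rfl
      map_smul' := fun k x => by
        rw [← algebraMap_smul R k x, map_smul, Coind.smul_eval, one_mul,
          Algebra.algebraMap_eq_smul_one, Coind.eval, map_smul]; rfl }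
  refine ⟨({ toFun := fun y => (ev ∘ₗ q ∘ₗ
                (LinearMap.toSpanSingleton R Y y).restrictScalars K : R →ₗ[K] M)
             map_add' := fun x y => LinearMap.ext fun s => by
               simp only [LinearMap.comp_apply, LinearMap.coe_restrictScalars,
                 LinearMap.toSpanSingleton_apply, smul_add, map_add]; rfl
             map_smul' := fun r x => LinearMap.ext fun s =>
               congrArg (fun y => ev (q y)) (mul_smul s r x).symm } :
               Y →ₗ[R] Coind K R M), fun x => ?_⟩
  refine LinearMap.ext fun s => ?_
  change (g (q (s • f x))).eval 1 = (g x).eval s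
  rw [← map_smul, hq', map_smul, Coind.smul_eval, one_mul]

/-- Every finite dimensional module has a finite dimensional injective hull. -/
theorem exists_injectiveHull (M : FDMod K R) :
    ∃ (I : FDMod K R) (f : M →ₗ[R] I), IsInjectiveHull f := by
  classical
  have hex : ∃ n : ℕ, ∃ (I : FDMod K R) (f : M →ₗ[R] I), Module.Injective R I ∧
      Function.Injective f ∧ Module.finrank K I = n := by
    obtain ⟨I, f, hI, hf⟩ := exists_injective M
    exact ⟨_, I, f, hI, hf, rfl⟩
  obtain ⟨I, f, hI, hf, hn⟩ := Nat.find_spec hex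
  refine ⟨I, f, hI, hf, fun N hN => ?_⟩
  have hs : Function.Injective (N.mkQ ∘ₗ f) := by
    rw [injective_iff_map_eq_zero]
    intro m hm
    have h1 : f m ∈ N ⊓ LinearMap.range f := ⟨(Submodule.Quotient.mk_eq_zero N).1 hm, m, rfl⟩
    rw [hN, Submodule.mem_bot] at h1
    exact (injective_iff_map_eq_zero f).1 hf m h1
  obtain ⟨h, hh⟩ := hI.out (N.mkQ ∘ₗ f) hs f
  set g : I →ₗ[R] I := h ∘ₗ N.mkQ with hg
  have hfg : ∀ n x, (g ^ n) (f x) = f x := by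
    intro n
    induction n with
    | zero => simp
    | succ n ih =>
      intro x
      rw [pow_succ, Module.End.mul_apply]
      exact (congrArg _ (hh x)).trans (ih x)
  have : IsNoetherian R I := isNoetherian_of_tower K inferInstance
  have : IsArtinian R I := isArtinian_of_tower K inferInstance
  obtain ⟨n, hn1, hc⟩ := ((Filter.eventually_ge_atTop 1).and
    (LinearMap.eventually_isCompl_ker_pow_range_pow g)).exists
  set Q : Submodule R I := LinearMap.range (g ^ n)
  have hQ : Module.Injective R Q :=
    injective_of_retract Q.subtype (Submodule.projectionOnto Q _ hc.symm) (by simp) hI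
  have hle := Nat.find_min' hex ⟨of K R Q, f.codRestrict Q fun m => ⟨f m, hfg n m⟩, hQ,
    fun x y hxy => hf (congrArg Subtype.val hxy), rfl⟩
  rw [← hn] at hle
  have htop : Q.restrictScalars K = ⊤ :=
    Submodule.eq_top_of_finrank_eq (le_antisymm (Submodule.finrank_le _) hle)
  have hQtop : Q = ⊤ := by simpa using htop
  have hker : LinearMap.ker (g ^ n) = ⊥ := by
    have := hc.inf_eq_bot
    rwa [hQtop, inf_top_eq] at this
  refine le_bot_iff.1 (hker ▸ ?_)
  intro x hx
  obtain ⟨k, rfl⟩ : ∃ k, n = k + 1 := ⟨n - 1, by omega⟩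
  rw [LinearMap.mem_ker, pow_succ, Module.End.mul_apply]
  have : g x = 0 := by simp [hg, (Submodule.Quotient.mk_eq_zero N).2 hx]
  rw [this, map_zero]

/-- The projective cover of `M`. -/
noncomputable def projCover (M : FDMod K R) : FDMod K R := M.exists_projectiveCover.choose

/-- The covering map of the projective cover of `M`. -/
noncomputable def projCoverMap (M : FDMod K R) : M.projCover →ₗ[R] M :=
  M.exists_projectiveCover.choose_spec.choose

theorem isProjectiveCover_projCoverMap (M : FDMod K R) : IsProjectiveCover M.projCoverMap :=
  M.exists_projectiveCover.choose_spec.choose_spec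

/-- The injective hull of `M`. -/
noncomputable def injHull (M : FDMod K R) : FDMod K R := M.exists_injectiveHull.choose

/-- The embedding of `M` into its injective hull. -/
noncomputable def injHullMap (M : FDMod K R) : M →ₗ[R] M.injHull :=
  M.exists_injectiveHull.choose_spec.choose

theorem isInjectiveHull_injHullMap (M : FDMod K R) : IsInjectiveHull M.injHullMap :=
  M.exists_injectiveHull.choose_spec.choose_spec

/-- The syzygy `Ω(M)`: the kernel of the projective cover. -/
noncomputable def syzygy (M : FDMod K R) : FDMod K R :=
  of K R (LinearMap.ker M.projCoverMap)

/-- The cosyzygy `Ω⁻¹(M)`: the cokernel of the injective hull. -/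
noncomputable def cosyzygy (M : FDMod K R) : FDMod K R :=
  of K R (M.injHull ⧸ LinearMap.range M.injHullMap)

/-- The `i`-th term `Iᵢ` of the minimal injective resolution `0 → M → I₀ → I₁ → ⋯`, which is the
injective hull of `Ω⁻ⁱ(M)`. -/
noncomputable def injResolution (M : FDMod K R) (i : ℕ) : FDMod K R :=
  (cosyzygy^[i] M).injHull

/-- The dominant dimension: the supremum of all `n` such that `I₀, …, Iₙ₋₁` are projective. -/
noncomputable def domDim (M : FDMod K R) : ℕ∞ :=
  ⨆ n : {n : ℕ // ∀ i < n, Module.Projective R (M.injResolution i)}, (n : ℕ∞)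

/-- The map `P₁ → P₀` of the minimal projective presentation `P₁ → P₀ → M → 0`, where `P₀` is the
projective cover of `M` and `P₁` is the projective cover of `Ω(M)`. -/
noncomputable def presentationMap (M : FDMod K R) : M.syzygy.projCover →ₗ[R] M.projCover :=
  (LinearMap.ker M.projCoverMap).subtype ∘ₗ M.syzygy.projCoverMap

end Resolutions

/-! ### Duality, transpose and the Auslander-Reiten translates -/

section Duality

variable {K : Type u} {A : Type u} [Field K] [Ring A] [Algebra K A]

/-- The `K`-dual `D(M)` of a left `A`-module `M` is a right `A`-module by `(f a)(m) = f(a m)`. -/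
def dualOfLeft (M : FDMod K A) : FDMod K Aᵐᵒᵖ where
  carrier := M →ₗ[K] K
  module :=
    { smul := fun a f => f ∘ₗ Module.toModuleEnd K M (unop a)
      one_smul := fun f => LinearMap.ext fun m => congrArg f (one_smul A m)
      mul_smul := fun a b f => LinearMap.ext fun m => congrArg f (mul_smul (unop b) (unop a) m)
      smul_zero := fun _ => rfl
      smul_add := fun _ _ _ => rfl
      add_smul := fun a b f => LinearMap.ext fun m =>
        (congrArg f (add_smul (unop a) (unop b) m)).trans (map_add f _ _)
      zero_smul := fun f => LinearMap.ext fun m =>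
        (congrArg f (zero_smul A m)).trans (map_zero f) }
  isScalarTower := @IsScalarTower.mk _ _ _ _ (_) _ fun k a f => LinearMap.ext fun m =>
    (congrArg f (smul_assoc k (unop a) m)).trans (map_smul f k _)

/-- The `K`-dual `D(M)` of a right `A`-module `M` is a left `A`-module by `(a f)(m) = f(m a)`. -/
def dualOfRight (M : FDMod K Aᵐᵒᵖ) : FDMod K A where
  carrier := M →ₗ[K] K
  module :=
    { smul := fun a f => f ∘ₗ Module.toModuleEnd K M (op a)
      one_smul := fun f => LinearMap.ext fun m => congrArg f (one_smul Aᵐᵒᵖ m)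
      mul_smul := fun a b f => LinearMap.ext fun m => congrArg f (mul_smul (op b) (op a) m)
      smul_zero := fun _ => rfl
      smul_add := fun _ _ _ => rfl
      add_smul := fun a b f => LinearMap.ext fun m =>
        (congrArg f (add_smul (op a) (op b) m)).trans (map_add f _ _)
      zero_smul := fun f => LinearMap.ext fun m =>
        (congrArg f (zero_smul Aᵐᵒᵖ m)).trans (map_zero f) }
  isScalarTower := @IsScalarTower.mk _ _ _ _ (_) _ fun k a f => LinearMap.ext fun m =>
    (congrArg f (smul_assoc k (op a) m)).trans (map_smul f k _)

theorem dualOfLeft_smul_apply (M : FDMod K A) (a : A) (f : M.dualOfLeft) (m : M) :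
    (show M →ₗ[K] K from op a • f) m = (show M →ₗ[K] K from f) (a • m) := rfl

theorem dualOfRight_smul_apply (M : FDMod K Aᵐᵒᵖ) (a : A) (f : M.dualOfRight) (m : M) :
    (show M →ₗ[K] K from a • f) m = (show M →ₗ[K] K from f) (op a • m) := rfl

variable [FiniteDimensional K A]

theorem finite_hom_of_left (P : FDMod K A) : FiniteDimensional K (P →ₗ[A] A) :=
  Module.Finite.of_injective (LinearMap.restrictScalarsₗ K A P A K)
    (LinearMap.restrictScalars_injective K)

theorem finite_hom_of_right (P : FDMod K Aᵐᵒᵖ) : FiniteDimensional K (P →ₗ[Aᵐᵒᵖ] A) :=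
  Module.Finite.of_injective (LinearMap.restrictScalarsₗ K Aᵐᵒᵖ P A K)
    (LinearMap.restrictScalars_injective K)

/-- The transpose `Tr(M)` of a left `A`-module: the cokernel of the right `A`-linear map
`Hom_A(P₀, A) → Hom_A(P₁, A)` induced by the minimal projective presentation `P₁ → P₀ → M → 0`. -/
noncomputable def transposeOfLeft (M : FDMod K A) : FDMod K Aᵐᵒᵖ :=
  haveI := finite_hom_of_left M.syzygy.projCover
  of K Aᵐᵒᵖ ((M.syzygy.projCover →ₗ[A] A) ⧸
    LinearMap.range (LinearMap.lcomp Aᵐᵒᵖ A M.presentationMap))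

/-- The transpose `Tr(M)` of a right `A`-module: the cokernel of the left `A`-linear map
`Hom_A(P₀, A) → Hom_A(P₁, A)` induced by the minimal projective presentation `P₁ → P₀ → M → 0`. -/
noncomputable def transposeOfRight (M : FDMod K Aᵐᵒᵖ) : FDMod K A :=
  haveI := finite_hom_of_right M.syzygy.projCover
  of K A ((M.syzygy.projCover →ₗ[Aᵐᵒᵖ] A) ⧸
    LinearMap.range (LinearMap.lcomp A A M.presentationMap))

/-- The Auslander-Reiten translate `τ = D Tr` of a right `A`-module. -/
noncomputable def tau (M : FDMod K Aᵐᵒᵖ) : FDMod K Aᵐᵒᵖ := M.transposeOfRight.dualOfLeft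

/-- The inverse Auslander-Reiten translate `τ⁻¹ = Tr D` of a right `A`-module. -/
noncomputable def tauInv (M : FDMod K Aᵐᵒᵖ) : FDMod K Aᵐᵒᵖ := M.dualOfRight.transposeOfLeft

/-- The codominant dimension of a right `A`-module `M`: the dominant dimension of `D(M)`. -/
noncomputable def codomDim (M : FDMod K Aᵐᵒᵖ) : ℕ∞ := M.dualOfRight.domDim

end Duality

end FDMod

/-! ### Gendo-symmetric algebras -/

section Algebras

variable (K : Type u) {A : Type u} [Field K] [Ring A] [Algebra K A] [FiniteDimensional K A]

/-- The left ideal `Ae`. -/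
abbrev leftIdeal (e : A) : Submodule A A := LinearMap.range (LinearMap.toSpanSingleton A A e)

/-- The right ideal `eA`. -/
abbrev rightIdeal (e : A) : Submodule Aᵐᵒᵖ A :=
  LinearMap.range (LinearMap.toSpanSingleton Aᵐᵒᵖ A e)

/-- Right multiplication by the element `ece` of `eAe` on `Ae`. -/
def mulRightCorner (e c : A) : leftIdeal e →ₗ[K] leftIdeal e where
  toFun x := ⟨(x : A) * (e * c * e), (x : A) * (e * c), by simp [mul_assoc]⟩
  map_add' x y := Subtype.ext (by simp [add_mul])
  map_smul' k x := Subtype.ext (by simp)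

/-- `eA` (with `e` idempotent) is a minimal faithful projective-injective right `A`-module:
it is projective, injective and faithful, and it is a direct summand of every finite dimensional
faithful right `A`-module. -/
structure IsMinimalFaithfulProjInj (e : A) : Prop where
  idempotent : IsIdempotentElem e
  projective : Module.Projective Aᵐᵒᵖ (rightIdeal e)
  injective : Module.Injective Aᵐᵒᵖ (rightIdeal e)
  faithful : FaithfulSMul Aᵐᵒᵖ (rightIdeal e)
  minimal : ∀ X : FDMod K Aᵐᵒᵖ, FaithfulSMul Aᵐᵒᵖ X →
    ∃ (i : rightIdeal e →ₗ[Aᵐᵒᵖ] X) (p : X →ₗ[Aᵐᵒᵖ] rightIdeal e), p ∘ₗ i = LinearMap.id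

/-- `D(Ae) ≅ eA` as `(eAe, A)`-bimodules, where `b ∈ eAe` acts on `D(Ae)` by
`(b f)(x) = f(x b)`. -/
def DualIsoAsBimodule (e : A) : Prop :=
  ∃ φ : (FDMod.of K A (leftIdeal e)).dualOfLeft ≃ₗ[Aᵐᵒᵖ] rightIdeal e,
    ∀ (c : A) (f : leftIdeal e →ₗ[K] K),
      (φ (f ∘ₗ mulRightCorner K e c : leftIdeal e →ₗ[K] K) : A) = (e * c * e) * (φ f : A)

variable (A) in
/-- A gendo-symmetric algebra: the dominant dimension of `A` is at least `2` and
`D(Ae) ≅ eA` as `(eAe, A)`-bimodules, where `eA` is the minimal faithful projective-injective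
right `A`-module. -/
structure IsGendoSymmetric : Prop where
  two_le_domDim : 2 ≤ (FDMod.of K Aᵐᵒᵖ A).domDim
  exists_idempotent : ∃ e : A, IsMinimalFaithfulProjInj K e ∧ DualIsoAsBimodule K e

end Algebras

end GendoSymm

/-! The isomorphism D(Ae) ≅ eA amounts to a linear form `t` on A which is symmetric on eAe and makes
the pairing t(xy) : eA × Ae → K perfect (`exists_isSymmetricIdempotent`). These data are left-right
symmetric, so the argument is carried out for left modules over a ring R, taken to be A or `Aᵐᵒᵖ`.
The form gives Re ≅ D(eR), hence add(Re) is exactly the class of finite dimensional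
projective-injective modules. Therefore domdim X ≥ 2 means that X is the kernel of a map inside
add(Re), equivalently that X → Hom_{eRe}(eR, eX) is bijective (`FDMod.two_le_domDim_iff_isClosed`).
Dually, codomdim M ≥ 2 means that both terms of the minimal projective presentation d : P₁ → P₀ of M
lie in add(Re) (`FDMod.isCoclosed_iff`).

Now τM is the kernel of ν(P₁) → ν(P₀) with ν = D Hom_R(-, R), while Ω²M is the kernel of d. On
add(Re) the form `t` yields a natural isomorphism from the identity to ν, so the two kernels agree
as soon as codomdim M ≥ 2 (`IsNakayamaKernel.nonempty_equiv_ker`).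

Conversely, domdim R ≥ 2 makes Ω²M closed, being a kernel between projectives. If τM ≅ Ω²M, then τM
is closed too. Its torsion-freeness forces P₁ into add(Re). The rest of closedness shows that the
projective cover of P₀/ReP₀ is a direct summand of M. Such a summand is projective, hence injective
by hypothesis, hence in add(Re); so P₀/ReP₀ = 0 and P₀ lies in add(Re)
(`FDMod.isCoclosed_of_equiv`).

The statement on τ⁻¹ is the one on τ for the opposite side, applied to D(M). -/

namespace GendoSymm

open MulOpposite Module

/-! ### Linear functionals -/

section Functionals

variable {K : Type u} [Field K]

/-- In the dual of a finite dimensional `W`, every subspace is the annihilator of its common kernel.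
Nondegeneracy on one side therefore gives representability of functionals. -/
theorem exists_apply_eq_of_separating {V W : Type u} [AddCommGroup V] [Module K V]
    [AddCommGroup W] [Module K W] [FiniteDimensional K W] (B : V →ₗ[K] W →ₗ[K] K)
    (l : W →ₗ[K] K) (h : ∀ w, (∀ v, B v w = 0) → l w = 0) : ∃ v, B v = l := by
  have h1 : l ∈ (Submodule.dualCoannihilator (LinearMap.range B)).dualAnnihilator := by
    rw [Submodule.mem_dualAnnihilator]
    intro w hw
    rw [Submodule.mem_dualCoannihilator] at hw
    exact h w fun v => hw _ ⟨v, rfl⟩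
  rw [Subspace.dualCoannihilator_dualAnnihilator_eq] at h1
  exact h1

variable {R : Type u} [Ring R] [Algebra K R]

theorem Submodule.exists_functional_of_notMem {M : Type u} [AddCommGroup M] [Module K M]
    [Module R M] [IsScalarTower K R M] (N : Submodule R M) {x : M} (hx : x ∉ N) :
    ∃ l : M →ₗ[K] K, l x ≠ 0 ∧ ∀ n ∈ N, l n = 0 := by
  obtain ⟨l, hl, hN⟩ := Submodule.exists_le_ker_of_notMem (p := N.restrictScalars K) (v := x)
    (by simpa using hx)
  exact ⟨l, hl, fun n hn => hN (by simpa using hn)⟩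

theorem exists_dualBasis (P : Type u) [AddCommGroup P] [Module R P] [Module.Projective R P]
    [Module.Finite R P] : ∃ (n : ℕ) (p : Fin n → P) (h : Fin n → P →ₗ[R] R),
      ∀ x, ∑ i, h i x • p i = x := by
  obtain ⟨n, f, hf⟩ := Module.Finite.exists_fin' R P
  obtain ⟨s, hs⟩ := Module.projective_lifting_property f LinearMap.id hf
  refine ⟨n, fun i => f (Pi.single i 1), fun i => LinearMap.proj i ∘ₗ s, fun x => ?_⟩
  have h1 : f (s x) = x := LinearMap.congr_fun hs x
  conv_rhs => rw [← h1, ← Finset.univ_sum_single (s x), map_sum]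
  refine Finset.sum_congr rfl fun i _ => ?_
  simp only [LinearMap.comp_apply, LinearMap.proj_apply, ← map_smul]
  rw [← Pi.single_smul, smul_eq_mul, mul_one]

theorem projective_of_dualBasis {P : Type u} [AddCommGroup P] [Module R P] {n : ℕ}
    (p : Fin n → P) (h : Fin n → P →ₗ[R] R) (hp : ∀ x, ∑ i, h i x • p i = x) :
    Module.Projective R P := by
  refine Module.Projective.of_split (LinearMap.pi h) (Fintype.linearCombination R p) ?_
  ext x
  simp [Fintype.linearCombination_apply, hp]

end Functionals

/-! ### Symmetric idempotents -/

section SymmetricIdempotent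

variable (K : Type u) {R : Type u} [Field K] [Ring R] [Algebra K R]

/-- An idempotent `e` with a linear form `t` on `eRe` (extended to `R` by zero) which makes `eRe`
symmetric, such that the pairing `eR × Re → K`, `(x, y) ↦ t (x y)` is perfect and
`R` acts faithfully on `eR`. -/
structure IsSymmetricIdempotent (e : R) (t : R →ₗ[K] K) : Prop where
  idem : e * e = e
  left : ∀ a, t (e * a) = t a
  right : ∀ a, t (a * e) = t a
  symm : ∀ a b, t (a * e * b) = t (b * e * a)
  nondeg_left : ∀ x, (∀ y, t (x * y) = 0) → e * x = 0
  nondeg_right : ∀ y, (∀ x, t (x * y) = 0) → y * e = 0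
  faithful : ∀ a, (∀ x, e * x * a = 0) → a = 0

variable {K} {e : R} {t : R →ₗ[K] K}

namespace IsSymmetricIdempotent

theorem ext_right (H : IsSymmetricIdempotent K e t) {y z : R} (hy : y * e = y) (hz : z * e = z)
    (h : ∀ x, t (x * y) = t (x * z)) : y = z := by
  have := H.nondeg_right (y - z) fun x => by rw [mul_sub, map_sub, h, sub_self]
  rwa [sub_mul, hy, hz, sub_eq_zero] at this

theorem ext_left (H : IsSymmetricIdempotent K e t) {y z : R} (hy : e * y = y) (hz : e * z = z)
    (h : ∀ x, t (y * x) = t (z * x)) : y = z := by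
  have := H.nondeg_left (y - z) fun x => by rw [sub_mul, map_sub, h, sub_self]
  rwa [mul_sub, hy, hz, sub_eq_zero] at this

/-- If aRe = 0, then eRa pairs to zero with Re, so eRa = 0 and faithfulness of eR applies. -/
theorem faithful' (H : IsSymmetricIdempotent K e t) (a : R) (h : ∀ x, a * x * e = 0) : a = 0 := by
  refine H.faithful a fun x => ?_
  have := H.nondeg_left (x * a) fun y => by
    rw [← H.right, mul_assoc, mul_assoc, ← mul_assoc a, h, mul_zero, map_zero]
  rwa [mul_assoc]

/-- Passing to the opposite ring exchanges eR and Re. This is what lets one argument serve left and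
right modules. -/
theorem op (H : IsSymmetricIdempotent K e t) :
    IsSymmetricIdempotent K (MulOpposite.op e) (t ∘ₗ (opLinearEquiv K).symm.toLinearMap) where
  idem := congrArg MulOpposite.op H.idem
  left a := H.right a.unop
  right a := H.left a.unop
  symm a b := by simpa [mul_assoc] using H.symm b.unop a.unop
  nondeg_left x h := unop_injective (H.nondeg_right x.unop fun y => h (MulOpposite.op y))
  nondeg_right x h := unop_injective (H.nondeg_left x.unop fun y => h (MulOpposite.op y))
  faithful a h := unop_injective (H.faithful' a.unop fun x => by
    simpa [mul_assoc] using congrArg unop (h (MulOpposite.op x)))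

variable [FiniteDimensional K R]

theorem exists_rep (H : IsSymmetricIdempotent K e t) (l : R →ₗ[K] K) :
    ∃ y, y * e = y ∧ ∀ x, t (x * y) = l (e * x) := by
  obtain ⟨y, hy⟩ := exists_apply_eq_of_separating
    (((LinearMap.mul K R).compr₂ t).flip) (l ∘ₗ LinearMap.mulLeft K e) fun w hw => by
      simp [H.nondeg_left w fun v => hw v]
  refine ⟨y * e, by rw [mul_assoc, H.idem], fun x => ?_⟩
  rw [← mul_assoc, H.right]
  exact LinearMap.congr_fun hy x

/-- The element of `Re` that represents a functional on `eR`. -/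
noncomputable def rep (H : IsSymmetricIdempotent K e t) (l : R →ₗ[K] K) : R :=
  (H.exists_rep l).choose

theorem rep_mul (H : IsSymmetricIdempotent K e t) (l : R →ₗ[K] K) : H.rep l * e = H.rep l :=
  (H.exists_rep l).choose_spec.1

theorem trace_mul_rep (H : IsSymmetricIdempotent K e t) (l : R →ₗ[K] K) (x : R) :
    t (x * H.rep l) = l (e * x) :=
  (H.exists_rep l).choose_spec.2 x

variable {X : Type u} [AddCommGroup X] [Module K X] [Module R X] [IsScalarTower K R X]

/-- The `R`-linear map `X → Re` that corresponds to a functional on `X`. -/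
noncomputable def repMap (H : IsSymmetricIdempotent K e t) (l : X →ₗ[K] K) : X →ₗ[R] R where
  toFun x := H.rep (l ∘ₗ (LinearMap.toSpanSingleton R X x).restrictScalars K)
  map_add' x y := H.ext_right (H.rep_mul _) (by rw [add_mul, H.rep_mul, H.rep_mul]) fun z => by
    rw [mul_add, map_add]
    simp [trace_mul_rep]
  map_smul' r x := H.ext_right (H.rep_mul _) (by simp [mul_assoc, H.rep_mul]) fun z => by
    rw [RingHom.id_apply, smul_eq_mul, ← mul_assoc]
    simp [trace_mul_rep, mul_smul]

theorem repMap_mul (H : IsSymmetricIdempotent K e t) (l : X →ₗ[K] K) (x : X) :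
    H.repMap l x * e = H.repMap l x := H.rep_mul _

theorem trace_mul_repMap (H : IsSymmetricIdempotent K e t) (l : X →ₗ[K] K) (r : R) (x : X) :
    t (r * H.repMap l x) = l ((e * r) • x) := H.trace_mul_rep _ r

end IsSymmetricIdempotent

end SymmetricIdempotent

/-! ### Modules that are cogenerated or copresented by `Re` -/

section Closed

variable {R : Type u} [Ring R]

/-- No nonzero element of `X` is annihilated by `eR`. -/
def IsTorsionFree (e : R) (X : Type u) [AddCommGroup X] [Module R X] : Prop :=
  ∀ x : X, (∀ r, (e * r) • x = 0) → x = 0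

/-- `X` is torsion-free, and every `eRe`-linear map `eR → eX` is given by an element of `X`. -/
structure IsClosed (K : Type u) [Field K] [Algebra K R] (e : R) (X : Type u) [AddCommGroup X]
    [Module K X] [Module R X] : Prop where
  torsionFree : IsTorsionFree e X
  exists_eq : ∀ f : R →ₗ[K] X, (∀ s r, f (e * s * e * r) = (e * s * e) • f r) →
    ∃ x, ∀ r, f (e * r) = (e * r) • x

/-- `P` is a direct summand of a finite direct sum of copies of `Re`. -/
def InAdd (e : R) (P : Type u) [AddCommGroup P] [Module R P] : Prop :=
  ∃ (n : ℕ) (p : Fin n → P) (h : Fin n → P →ₗ[R] R), (∀ i, e • p i = p i) ∧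
    (∀ i x, h i x * e = h i x) ∧ ∀ x, ∑ i, h i x • p i = x

theorem IsTorsionFree.of_injective {e : R} {X Y : Type u} [AddCommGroup X] [Module R X]
    [AddCommGroup Y] [Module R Y] (hY : IsTorsionFree e Y) (f : X →ₗ[R] Y)
    (hf : Function.Injective f) : IsTorsionFree e X := fun x hx =>
  (injective_iff_map_eq_zero f).1 hf x (hY _ fun r => by rw [← map_smul, hx, map_zero])

theorem InAdd.of_retract {e : R} {P Q : Type u} [AddCommGroup P] [Module R P]
    [AddCommGroup Q] [Module R Q] (hP : InAdd e P) (i : Q →ₗ[R] P) (p : P →ₗ[R] Q)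
    (hpi : ∀ x, p (i x) = x) : InAdd e Q := by
  obtain ⟨n, b, h, hb, hh, hs⟩ := hP
  refine ⟨n, fun k => p (b k), fun k => h k ∘ₗ i, fun k => by rw [← map_smul, hb],
    fun k x => hh k _, fun x => ?_⟩
  simp only [LinearMap.comp_apply, ← map_smul, ← map_sum, hs, hpi]

theorem InAdd.projective {e : R} {P : Type u} [AddCommGroup P] [Module R P] (hP : InAdd e P) :
    Module.Projective R P := by
  obtain ⟨n, b, h, hb, hh, hs⟩ := hP
  exact projective_of_dualBasis b h hs

/-- The submodule `(Re)ⁿ` of `Rⁿ`. -/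
def freeAt (e : R) (n : ℕ) : Submodule R (Fin n → R) where
  carrier := {v | ∀ i, v i * e = v i}
  add_mem' ha hb i := by rw [Pi.add_apply, add_mul, ha, hb]
  zero_mem' i := zero_mul e
  smul_mem' r v hv i := by rw [Pi.smul_apply, smul_eq_mul, mul_assoc, hv]

theorem inAdd_freeAt {e : R} (he : e * e = e) (n : ℕ) : InAdd e (freeAt e n) := by
  classical
  refine ⟨n, fun i => ⟨Pi.single i e, fun j => ?_⟩,
    fun i => LinearMap.proj i ∘ₗ (freeAt e n).subtype, fun i => ?_, fun i x => x.2 i,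
    fun x => ?_⟩
  · by_cases h : j = i
    · subst h; simp [he]
    · simp [Pi.single_eq_of_ne h]
  · ext1
    simp [← Pi.single_smul, he]
  · ext1
    simp only [LinearMap.comp_apply, LinearMap.proj_apply, Submodule.subtype_apply,
      Submodule.coe_sum, Submodule.coe_smul, ← Pi.single_smul, smul_eq_mul, x.2 _]
    exact Finset.univ_sum_single _

/-- The submodule `ReX` of `X`. -/
def traceSub (e : R) (X : Type u) [AddCommGroup X] [Module R X] : Submodule R X :=
  Submodule.span R (Set.range fun x : X => e • x)

theorem smul_mem_traceSub (e r : R) {X : Type u} [AddCommGroup X] [Module R X] (x : X) :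
    (r * e) • x ∈ traceSub e X := by
  rw [mul_smul]
  exact Submodule.smul_mem _ _ (Submodule.subset_span ⟨x, rfl⟩)

theorem map_mem_traceSub (e : R) {X Y : Type u} [AddCommGroup X] [Module R X] [AddCommGroup Y]
    [Module R Y] (f : X →ₗ[R] Y) {x : X} (hx : x ∈ traceSub e X) : f x ∈ traceSub e Y := by
  have : traceSub e X ≤ (traceSub e Y).comap f := by
    rw [traceSub, Submodule.span_le]
    rintro _ ⟨z, rfl⟩
    simp only [Submodule.comap_coe, Set.mem_preimage, map_smul, SetLike.mem_coe]
    exact Submodule.subset_span ⟨f z, rfl⟩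
  exact this hx

theorem traceSub_eq_top_of_surjective {e : R} {X Y : Type u} [AddCommGroup X] [Module R X]
    [AddCommGroup Y] [Module R Y] (f : X →ₗ[R] Y) (hf : Function.Surjective f)
    (hX : traceSub e X = ⊤) : traceSub e Y = ⊤ := by
  refine Submodule.eq_top_iff'.2 fun y => ?_
  obtain ⟨x, rfl⟩ := hf y
  exact map_mem_traceSub e f (hX ▸ Submodule.mem_top)

theorem InAdd.traceSub_eq_top {e : R} {P : Type u} [AddCommGroup P] [Module R P]
    (hP : InAdd e P) : traceSub e P = ⊤ := by
  obtain ⟨n, b, h, hb, hh, hs⟩ := hP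
  refine Submodule.eq_top_iff'.2 fun x => hs x ▸ Submodule.sum_mem _ fun i _ => ?_
  rw [← hb i, smul_smul]
  exact smul_mem_traceSub _ _ _

theorem traceSub_quotient (e : R) (X : Type u) [AddCommGroup X] [Module R X] :
    traceSub e (X ⧸ traceSub e X) = ⊥ := by
  refine eq_bot_iff.2 (Submodule.span_le.2 ?_)
  rintro _ ⟨x, rfl⟩
  obtain ⟨x, rfl⟩ := Submodule.mkQ_surjective _ x
  change e • (traceSub e X).mkQ x = 0
  rw [← map_smul, Submodule.mkQ_apply, Submodule.Quotient.mk_eq_zero]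
  exact Submodule.subset_span ⟨x, rfl⟩

/-- If P = ReP, a K-basis `b` gives generators `e • b i`, so P is a quotient of (Re)ⁿ, and
projectivity splits the quotient map. -/
theorem inAdd_of_traceSub_eq_top (K : Type u) [Field K] [Algebra K R] {e : R} (he : e * e = e)
    {P : Type u} [AddCommGroup P] [Module K P] [Module R P] [IsScalarTower K R P]
    [FiniteDimensional K P] [Module.Projective R P] (hP : traceSub e P = ⊤) : InAdd e P := by
  let b := Module.finBasis K P
  have hb : ∀ i, e • e • b i = e • b i := fun i => by rw [smul_smul, he]
  have hmem : ∀ x : P, x ∈ Submodule.span R (Set.range fun i => e • b i) := by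
    intro x
    have hx : x ∈ traceSub e P := hP ▸ Submodule.mem_top
    refine Submodule.span_le.2 ?_ hx
    rintro _ ⟨y, rfl⟩
    change e • y ∈ _
    rw [← b.sum_repr y, Finset.smul_sum]
    refine Submodule.sum_mem _ fun i _ => ?_
    rw [← algebraMap_smul R (b.repr y i), smul_smul, ← Algebra.commutes, ← smul_smul]
    exact Submodule.smul_mem _ _ (Submodule.subset_span ⟨i, rfl⟩)
  have hsurj : Function.Surjective (Fintype.linearCombination R fun i => e • b i) := by
    rw [← LinearMap.range_eq_top, Fintype.range_linearCombination]
    exact Submodule.eq_top_iff'.2 hmem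
  obtain ⟨s, hs⟩ := Module.projective_lifting_property _ LinearMap.id hsurj
  refine ⟨_, fun i => e • b i,
    fun i => LinearMap.toSpanSingleton R R e ∘ₗ LinearMap.proj i ∘ₗ s, hb,
    fun i x => by simp [mul_assoc, he], fun x => ?_⟩
  have h1 := LinearMap.congr_fun hs x
  simp only [LinearMap.comp_apply, Fintype.linearCombination_apply, LinearMap.id_apply] at h1
  conv_rhs => rw [← h1]
  refine Finset.sum_congr rfl fun i _ => ?_
  simp only [LinearMap.comp_apply, LinearMap.toSpanSingleton_apply, smul_eq_mul, mul_smul, hb,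
    LinearMap.proj_apply]

end Closed

/-! ### Dominant dimension at least two -/

section ClosedModules

variable {K R : Type u} [Field K] [Ring R] [Algebra K R] {e : R} {t : R →ₗ[K] K}

/-- The coordinates of an element annihilated by eR are annihilated by eR in R, so they vanish by
faithfulness. -/
theorem isTorsionFree_of_projective (H : IsSymmetricIdempotent K e t) (P : Type u)
    [AddCommGroup P] [Module R P] [Module.Projective R P] [Module.Finite R P] :
    IsTorsionFree e P := by
  obtain ⟨n, p, h, hp⟩ := exists_dualBasis (R := R) P
  intro x hx
  rw [← hp x]
  refine Finset.sum_eq_zero fun i _ => ?_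
  rw [H.faithful (h i x) fun r => ?_, zero_smul]
  rw [← smul_eq_mul, ← map_smul, hx, map_zero]

theorem IsClosed.of_projective (H : IsSymmetricIdempotent K e t) (hR : IsClosed K e R)
    (P : Type u) [AddCommGroup P] [Module K P] [Module R P] [IsScalarTower K R P]
    [FiniteDimensional K P] [Module.Projective R P] : IsClosed K e P := by
  have : Module.Finite R P := Module.Finite.of_restrictScalars_finite K R P
  refine ⟨isTorsionFree_of_projective H P, fun f hf => ?_⟩
  obtain ⟨n, p, h, hs⟩ := exists_dualBasis (R := R) P
  choose y hy using fun i => hR.exists_eq ((h i).restrictScalars K ∘ₗ f) fun s r => by simp [hf]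
  refine ⟨∑ i, y i • p i, fun r => ?_⟩
  rw [← hs (f (e * r)), Finset.smul_sum]
  exact Finset.sum_congr rfl fun i _ => by rw [← mul_smul]; exact congrArg (· • p i) (hy i r)

/-- A map eR → eX is given by an element c of C, and `d c` is annihilated by eR, so torsion-freeness
of T puts c into X. -/
theorem IsClosed.of_exact {X C T : Type u} [AddCommGroup X] [Module K X] [Module R X]
    [IsScalarTower K R X] [AddCommGroup C] [Module K C] [Module R C] [IsScalarTower K R C]
    [AddCommGroup T] [Module R T] (hC : IsClosed K e C)
    (hT : IsTorsionFree e T) (i : X →ₗ[R] C) (d : C →ₗ[R] T) (hi : Function.Injective i)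
    (hd : ∀ c, d c = 0 ↔ ∃ x, i x = c) : IsClosed K e X := by
  refine ⟨hC.torsionFree.of_injective i hi, fun f hf => ?_⟩
  obtain ⟨c, hc⟩ := hC.exists_eq (i.restrictScalars K ∘ₗ f) fun s r => by simp [hf]
  have h0 : d c = 0 := hT _ fun r => by
    rw [← map_smul, ← hc]
    exact (hd _).2 ⟨_, rfl⟩
  obtain ⟨x, rfl⟩ := (hd c).1 h0
  exact ⟨x, fun r => hi (by rw [map_smul, ← hc]; rfl)⟩

theorem IsClosed.of_linearEquiv {X Y : Type u} [AddCommGroup X] [Module K X] [Module R X]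
    [IsScalarTower K R X] [AddCommGroup Y] [Module K Y] [Module R Y] [IsScalarTower K R Y]
    (hX : IsClosed K e X) (f : Y ≃ₗ[R] X) : IsClosed K e Y :=
  hX.of_exact (T := PUnit) (fun _ _ => rfl) f.toLinearMap 0 f.injective fun c =>
    ⟨fun _ => f.surjective c, fun _ => rfl⟩

/-- If the class of c is annihilated by eR, then r ↦ erc is an eRe-linear map with values in X. It
is therefore given by some x in X, and c - x is annihilated by eR, hence zero. -/
theorem IsClosed.isTorsionFree_quotient (he : e * e = e) {X C : Type u} [AddCommGroup X]
    [Module K X] [Module R X]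
    [IsScalarTower K R X] [AddCommGroup C] [Module K C] [Module R C] [IsScalarTower K R C]
    (hX : IsClosed K e X) (hC : IsTorsionFree e C) (i : X →ₗ[R] C) (hi : Function.Injective i) :
    IsTorsionFree e (C ⧸ LinearMap.range i) := by
  have he' : ∀ r, e * (e * r) = e * r := fun r => by rw [← mul_assoc, he]
  intro c hc
  obtain ⟨c, rfl⟩ := Submodule.mkQ_surjective _ c
  have h1 : ∀ r, ∃ x, i x = (e * r) • c := fun r => by
    have := hc r
    rw [← map_smul, Submodule.mkQ_apply, Submodule.Quotient.mk_eq_zero] at this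
    exact this
  choose f hf using h1
  let F : R →ₗ[K] X :=
    { toFun := f
      map_add' := fun a b => hi (by rw [map_add, hf, hf, hf, mul_add, add_smul])
      map_smul' := fun k a => hi (by
        rw [RingHom.id_apply, LinearMap.map_smul_of_tower, hf, hf, mul_smul_comm, smul_assoc]) }
  obtain ⟨x, hx⟩ := hX.exists_eq F fun s r => hi (by
    change i (f _) = i (_ • f r)
    rw [map_smul, hf, hf, smul_smul]
    simp only [mul_assoc, he'])
  rw [Submodule.mkQ_apply, Submodule.Quotient.mk_eq_zero]
  refine ⟨x, ?_⟩
  rw [← sub_eq_zero]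
  refine hC _ fun r => ?_
  rw [smul_sub, ← map_smul, ← hx, sub_eq_zero]
  change i (f _) = _
  rw [hf, he']

end ClosedModules

/-! ### Injectivity of Re and embeddings into its powers -/

section InjectiveModules

variable {K R : Type u} [Field K] [Ring R] [Algebra K R] [FiniteDimensional K R]
  {e : R} {t : R →ₗ[K] K}

/-- Re is the dual of eR, so R-linear maps into Re correspond to functionals, and functionals
extend. -/
theorem InAdd.injective (H : IsSymmetricIdempotent K e t) {P : Type u} [AddCommGroup P]
    [Module K P] [Module R P] [IsScalarTower K R P] (hP : InAdd e P) :
    Module.Injective R P := by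
  obtain ⟨n, p, h, hp, hh, hs⟩ := hP
  refine ⟨fun X Y _ _ _ _ f hf g => ?_⟩
  let _ : Module K X := Module.compHom X (algebraMap K R)
  let _ : Module K Y := Module.compHom Y (algebraMap K R)
  have : IsScalarTower K R X := ⟨fun k r x => by
    change (k • r) • x = algebraMap K R k • r • x
    rw [Algebra.smul_def, mul_smul]⟩
  have : IsScalarTower K R Y := ⟨fun k r x => by
    change (k • r) • x = algebraMap K R k • r • x
    rw [Algebra.smul_def, mul_smul]⟩
  obtain ⟨q, hq⟩ := (f.restrictScalars K).exists_leftInverse_of_injective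
    (LinearMap.ker_eq_bot.2 hf)
  have hq' : ∀ x, q (f x) = x := fun x => LinearMap.congr_fun hq x
  -- The functional `t` of the i-th coordinate is extended along the K-linear retraction `q` and
  -- then turned back into an R-linear map to Re.
  let u : Fin n → Y →ₗ[R] R := fun i =>
    H.repMap (t ∘ₗ ((h i ∘ₗ g).restrictScalars K) ∘ₗ q)
  have hu : ∀ i x, u i (f x) = h i (g x) := fun i x =>
    H.ext_right (H.repMap_mul _ _) (hh _ _) fun r => by
      rw [H.trace_mul_repMap, ← map_smul]
      simp only [LinearMap.comp_apply, hq', LinearMap.coe_restrictScalars]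
      rw [map_smul, map_smul, smul_eq_mul, mul_assoc, H.left]
  refine ⟨Fintype.linearCombination R p ∘ₗ LinearMap.pi u, fun x => ?_⟩
  simp [Fintype.linearCombination_apply, hu, hs]

/-- The maps to Re attached to a basis of functionals vanish together only on elements annihilated
by eR. -/
theorem IsTorsionFree.exists_embedding (H : IsSymmetricIdempotent K e t) {X : Type u}
    [AddCommGroup X] [Module K X] [Module R X] [IsScalarTower K R X] [FiniteDimensional K X]
    (hX : IsTorsionFree e X) :
    ∃ (n : ℕ) (f : X →ₗ[R] freeAt e n), Function.Injective f := by
  let b := Module.finBasis K X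
  refine ⟨_, (LinearMap.pi fun i => H.repMap (b.coord i)).codRestrict (freeAt e _)
    fun x i => H.repMap_mul _ _, ?_⟩
  rw [injective_iff_map_eq_zero]
  intro x hx
  refine hX x fun r => ?_
  refine b.ext_elem fun i => ?_
  have h1 : H.repMap (b.coord i) x = 0 := congrFun (congrArg Subtype.val hx) i
  have h2 := H.trace_mul_repMap (b.coord i) r x
  rw [h1, mul_zero, map_zero] at h2
  simpa using h2.symm

theorem inAdd_of_injective (H : IsSymmetricIdempotent K e t) {X : Type u}
    [AddCommGroup X] [Module K X] [Module R X] [IsScalarTower K R X] [FiniteDimensional K X]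
    (hX : IsTorsionFree e X) (hI : Module.Injective R X) : InAdd e X := by
  obtain ⟨n, f, hf⟩ := hX.exists_embedding H
  obtain ⟨g, hg⟩ := hI.out f hf LinearMap.id
  exact (inAdd_freeAt H.idem n).of_retract f g hg

theorem InAdd.isClosed (H : IsSymmetricIdempotent K e t) {P : Type u} [AddCommGroup P]
    [Module K P] [Module R P] [IsScalarTower K R P] [FiniteDimensional K P]
    (hP : InAdd e P) : IsClosed K e P := by
  have := hP.projective
  have : Module.Finite R P := Module.Finite.of_restrictScalars_finite K R P
  refine ⟨isTorsionFree_of_projective H P, fun f hf => ?_⟩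
  obtain ⟨n, p, h, hp, hh, hs⟩ := hP
  -- Each coordinate of `f` is an eRe-linear map on eR with values in eRe. Composed with `t` it is a
  -- functional on eR, and the element of Re representing that functional also represents the
  -- coordinate.
  let y : Fin n → R := fun i => H.rep (t ∘ₗ (h i).restrictScalars K ∘ₗ f)
  have hf1 : ∀ r, f (e * r) = e • f r := fun r => by simpa [H.idem] using hf 1 r
  have key : ∀ i r, h i (f (e * r)) = e * r * y i := fun i r => by
    refine H.ext_right (hh _ _) (by rw [mul_assoc, H.rep_mul]) fun s => ?_
    rw [← mul_assoc, H.trace_mul_rep]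
    simp only [LinearMap.comp_apply, LinearMap.coe_restrictScalars]
    have h2 : e * (s * (e * r)) = e * s * e * r := by simp only [mul_assoc]
    rw [h2, hf, map_smul, hf1, map_smul, smul_eq_mul, smul_eq_mul, ← H.left]
    simp only [mul_assoc]
  refine ⟨∑ i, y i • p i, fun r => ?_⟩
  rw [← hs (f (e * r)), Finset.smul_sum]
  exact Finset.sum_congr rfl fun i _ => by rw [key, mul_smul]

end InjectiveModules

/-! ### Dominant dimension at least two as closedness -/

section DomDim

variable {K R : Type u} [Field K] [Ring R] [Algebra K R] [FiniteDimensional K R]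
  {e : R} {t : R →ₗ[K] K}

theorem FDMod.two_le_domDim_iff (X : FDMod K R) :
    2 ≤ X.domDim ↔
      Module.Projective R X.injHull ∧ Module.Projective R X.cosyzygy.injHull := by
  constructor
  · intro h
    have h1 : (1 : ℕ∞) < X.domDim := lt_of_lt_of_le (by norm_num) h
    obtain ⟨⟨n, hn⟩, h2⟩ := lt_iSup_iff.1 h1
    have h3 : 1 < n := by exact_mod_cast h2
    exact ⟨hn 0 (by omega), hn 1 h3⟩
  · rintro ⟨h0, h1⟩
    refine le_iSup_of_le ⟨2, fun i hi => ?_⟩ le_rfl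
    interval_cases i
    · exact h0
    · exact h1

/-- The embedding of M extends to I → J, and its kernel meets the essential submodule M trivially,
so I embeds in J. -/
theorem IsInjectiveHull.isTorsionFree {M I : Type u} [AddCommGroup M] [Module R M]
    [AddCommGroup I] [Module R I] {f : M →ₗ[R] I} (hf : IsInjectiveHull f) {J : Type u}
    [AddCommGroup J] [Module R J] (hJ : Module.Injective R J) (hJ' : IsTorsionFree e J)
    (g : M →ₗ[R] J) (hg : Function.Injective g) : IsTorsionFree e I := by
  obtain ⟨k, hk⟩ := hJ.out f hf.injective_map g
  refine hJ'.of_injective k (LinearMap.ker_eq_bot.1 (hf.essential _ ?_))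
  rw [eq_bot_iff]
  rintro _ ⟨h1, x, rfl⟩
  have h2 : k (f x) = 0 := h1
  rw [hk] at h2
  rw [(injective_iff_map_eq_zero g).1 hg x h2, map_zero]
  exact Submodule.zero_mem _

theorem FDMod.inAdd_injHull (H : IsSymmetricIdempotent K e t) (X : FDMod K R)
    (hX : IsTorsionFree e X) : InAdd e X.injHull := by
  obtain ⟨n, f, hf⟩ := hX.exists_embedding H
  exact inAdd_of_injective H (X.isInjectiveHull_injHullMap.isTorsionFree
    ((inAdd_freeAt H.idem n).injective H)
    (((inAdd_freeAt H.idem n).isClosed H).torsionFree) f hf)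
    X.isInjectiveHull_injHullMap.injective

/-- If I₀ and I₁ are projective, then I₀ is in add(Re), hence closed, and the cosyzygy is
torsion-free inside I₁, so X is closed. If X is closed, X and its cosyzygy are torsion-free, which
puts both injective hulls in add(Re). -/
theorem FDMod.two_le_domDim_iff_isClosed (H : IsSymmetricIdempotent K e t) (X : FDMod K R) :
    2 ≤ X.domDim ↔ IsClosed K e X := by
  rw [two_le_domDim_iff]
  constructor
  · rintro ⟨h0, h1⟩
    have f0 : Module.Finite R X.injHull := Module.Finite.of_restrictScalars_finite K R _
    have f1 : Module.Finite R X.cosyzygy.injHull := Module.Finite.of_restrictScalars_finite K R _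
    have t0 := isTorsionFree_of_projective H X.injHull
    have t1 := isTorsionFree_of_projective H X.cosyzygy.injHull
    have c0 := (inAdd_of_injective H t0 X.isInjectiveHull_injHullMap.injective).isClosed H
    refine c0.of_exact (t1.of_injective _ X.cosyzygy.isInjectiveHull_injHullMap.injective_map)
      X.injHullMap (LinearMap.range X.injHullMap).mkQ X.isInjectiveHull_injHullMap.injective_map
      fun c => (Submodule.Quotient.mk_eq_zero _).trans Iff.rfl
  · intro h
    have h0 := X.inAdd_injHull H h.torsionFree
    exact ⟨h0.projective, (X.cosyzygy.inAdd_injHull H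
      (h.isTorsionFree_quotient H.idem (h0.isClosed H).torsionFree X.injHullMap
        X.isInjectiveHull_injHullMap.injective_map)).projective⟩

end DomDim

/-! ### The kernel of the Nakayama functor on a map of projective modules -/

section NakayamaKernel

variable {K R : Type u} [Field K] [Ring R] [Algebra K R]

/-- The functional `h ↦ ∑ t (h (pᵢ) hᵢ (x))` on `Hom_R(P, R)`. -/
noncomputable def nakayamaPairing (t : R →ₗ[K] K) {P : Type u} [AddCommGroup P] [Module K P]
    [Module R P] [IsScalarTower K R P] {n : ℕ} (p : Fin n → P) (h : Fin n → P →ₗ[R] R) :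
    P →ₗ[K] (P →ₗ[R] R) →ₗ[K] K :=
  LinearMap.mk₂ K (fun x f => ∑ i, t (f (p i) * h i x))
    (fun x y f => by simp [mul_add, Finset.sum_add_distrib])
    (fun k x f => by simp [Finset.mul_sum, LinearMap.map_smul_of_tower])
    (fun x f g => by simp [add_mul, Finset.sum_add_distrib])
    (fun k x f => by simp [Finset.mul_sum])

theorem nakayamaPairing_apply (t : R →ₗ[K] K) {P : Type u} [AddCommGroup P] [Module K P]
    [Module R P] [IsScalarTower K R P] {n : ℕ} (p : Fin n → P) (h : Fin n → P →ₗ[R] R)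
    (x : P) (f : P →ₗ[R] R) : nakayamaPairing t p h x f = ∑ i, t (f (p i) * h i x) := rfl

variable {e : R} {t : R →ₗ[K] K}

/-- Expanding in both dual bases gives the same double sum up to a cyclic rotation under `t`, which
is allowed by symmetry on eRe. -/
theorem nakayamaPairing_naturality (H : IsSymmetricIdempotent K e t) {P Q : Type u}
    [AddCommGroup P] [Module K P] [Module R P] [IsScalarTower K R P]
    [AddCommGroup Q] [Module K Q] [Module R Q] [IsScalarTower K R Q]
    {n m : ℕ} {p : Fin n → P} {h : Fin n → P →ₗ[R] R} {q : Fin m → Q} {g : Fin m → Q →ₗ[R] R}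
    (hh : ∀ i x, h i x * e = h i x) (hp : ∀ x, ∑ i, h i x • p i = x)
    (hg : ∀ i x, g i x * e = g i x) (hq : ∀ x, ∑ i, g i x • q i = x)
    (d : P →ₗ[R] Q) (x : P) (f : Q →ₗ[R] R) :
    nakayamaPairing t q g (d x) f = nakayamaPairing t p h x (f ∘ₗ d) := by
  simp only [nakayamaPairing_apply, LinearMap.comp_apply]
  have h1 : ∀ j, t (f (q j) * g j (d x)) = ∑ i, t (g j (d (p i)) * (f (q j) * h i x)) := by
    intro j
    conv_lhs => rw [← hp x]
    rw [map_sum, map_sum, Finset.mul_sum, map_sum]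
    refine Finset.sum_congr rfl fun i _ => ?_
    rw [map_smul, map_smul, smul_eq_mul, ← mul_assoc, ← hh i x, ← mul_assoc, H.symm,
      hg, mul_assoc, hh]
  have h2 : ∀ i, t (f (d (p i)) * h i x) = ∑ j, t (g j (d (p i)) * (f (q j) * h i x)) := by
    intro i
    conv_lhs => rw [← hq (d (p i))]
    rw [map_sum, Finset.sum_mul, map_sum]
    refine Finset.sum_congr rfl fun j _ => ?_
    rw [map_smul, smul_eq_mul, mul_assoc]
  simp only [h1, h2]
  exact Finset.sum_comm

theorem nakayamaPairing_smul (t : R →ₗ[K] K) {P : Type u} [AddCommGroup P] [Module K P]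
    [Module R P] [IsScalarTower K R P] {n : ℕ} (p : Fin n → P) (h : Fin n → P →ₗ[R] R)
    (r : R) (x : P) (f : P →ₗ[R] R) : nakayamaPairing t p h (r • x) f =
      nakayamaPairing t p h x (LinearMap.toSpanSingleton R R r ∘ₗ f) := by
  simp [nakayamaPairing_apply, mul_assoc]

/-- Testing against `h j` followed by right multiplication by `e * y` gives t(y · h_j(x)), so all
coordinates of `x` vanish. -/
theorem nakayamaPairing_injective (H : IsSymmetricIdempotent K e t) {P : Type u}
    [AddCommGroup P] [Module K P] [Module R P] [IsScalarTower K R P]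
    {n : ℕ} {p : Fin n → P} {h : Fin n → P →ₗ[R] R}
    (hh : ∀ i x, h i x * e = h i x) (hp : ∀ x, ∑ i, h i x • p i = x) {x : P}
    (hx : nakayamaPairing t p h x = 0) : x = 0 := by
  rw [← hp x]
  refine Finset.sum_eq_zero fun j _ => ?_
  rw [← hh, H.nondeg_right (h j x) fun y => ?_, zero_smul]
  have h1 := LinearMap.congr_fun hx (LinearMap.toSpanSingleton R R (e * y) ∘ₗ h j)
  rw [LinearMap.zero_apply, nakayamaPairing_apply] at h1
  rw [← h1]
  conv_lhs => rw [← hp x]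
  rw [map_sum, Finset.mul_sum, map_sum]
  refine Finset.sum_congr rfl fun i _ => ?_
  simp only [map_smul, smul_eq_mul, LinearMap.comp_apply, LinearMap.toSpanSingleton_apply]
  rw [← mul_assoc _ e, mul_assoc _ y, H.symm, mul_assoc y _ e, hh, mul_assoc]

/-- It suffices that no nonzero `f` pairs to zero with all of P. Pairing `f` with `r • p j` gives
t(f(p_j) r), which forces f(p_j) = 0. -/
theorem nakayamaPairing_surjective (H : IsSymmetricIdempotent K e t) {P : Type u}
    [AddCommGroup P] [Module K P] [Module R P] [IsScalarTower K R P]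
    [FiniteDimensional K (P →ₗ[R] R)]
    {n : ℕ} {p : Fin n → P} {h : Fin n → P →ₗ[R] R} (he : ∀ i, e • p i = p i)
    (hh : ∀ i x, h i x * e = h i x) (hp : ∀ x, ∑ i, h i x • p i = x)
    (l : (P →ₗ[R] R) →ₗ[K] K) : ∃ x, nakayamaPairing t p h x = l := by
  refine exists_apply_eq_of_separating _ l fun f hf => ?_
  have h0 : ∀ j, f (p j) = 0 := by
    intro j
    rw [← he j, map_smul, smul_eq_mul]
    refine H.nondeg_left _ fun r => ?_
    have h1 := hf (r • p j)
    rw [nakayamaPairing_apply] at h1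
    rw [← h1]
    conv_lhs => rw [← hp (p j)]
    rw [map_sum, Finset.sum_mul, map_sum]
    refine Finset.sum_congr rfl fun i _ => ?_
    rw [map_smul, map_smul, smul_eq_mul, smul_eq_mul, mul_assoc]
    conv_rhs => rw [← he j, map_smul, smul_eq_mul, ← mul_assoc, ← mul_assoc, H.symm, hh]
  have h1 : f = 0 := by
    ext x
    rw [← hp x, map_sum]
    simp [h0]
  rw [h1, map_zero]

/-- `T` is the kernel of `ν(P₁) → ν(P₀)`, where `ν = D Hom_R(-, R)` is the Nakayama functor. -/
structure IsNakayamaKernel {P₁ P₀ : Type u} [AddCommGroup P₁] [Module R P₁] [AddCommGroup P₀]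
    [Module R P₀] (d : P₁ →ₗ[R] P₀) {T : Type u} [AddCommGroup T] [Module K T] [Module R T]
    (i : T →ₗ[K] (P₁ →ₗ[R] R) →ₗ[K] K) : Prop where
  injective : Function.Injective i
  exists_eq_iff : ∀ l : (P₁ →ₗ[R] R) →ₗ[K] K,
    (∃ x, i x = l) ↔ ∀ f : P₀ →ₗ[R] R, l (f ∘ₗ d) = 0
  smul_apply : ∀ (r : R) (x : T) (f : P₁ →ₗ[R] R),
    i (r • x) f = i x (LinearMap.toSpanSingleton R R r ∘ₗ f)

theorem hom_finiteDimensional [FiniteDimensional K R] (P : Type u) [AddCommGroup P] [Module K P]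
    [Module R P] [IsScalarTower K R P] [FiniteDimensional K P] :
    FiniteDimensional K (P →ₗ[R] R) :=
  Module.Finite.of_injective (LinearMap.restrictScalarsₗ K R P R K)
    (LinearMap.restrictScalars_injective K)

section

variable {P₁ P₀ : Type u} [AddCommGroup P₁] [Module R P₁] [AddCommGroup P₀] [Module R P₀]
  {d : P₁ →ₗ[R] P₀} {T : Type u} [AddCommGroup T] [Module K T] [Module R T]
  {i : T →ₗ[K] (P₁ →ₗ[R] R) →ₗ[K] K}

/-- By naturality the isomorphisms P → ν(P) on add(Re) match the kernel of `d` with the kernel of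
ν(d). -/
theorem IsNakayamaKernel.nonempty_equiv_ker [FiniteDimensional K R]
    [Module K P₁] [IsScalarTower K R P₁] [FiniteDimensional K P₁] [Module K P₀] [IsScalarTower K R P₀]
    (H : IsSymmetricIdempotent K e t)
    (hi : IsNakayamaKernel d i) (h₁ : InAdd e P₁) (h₀ : InAdd e P₀) :
    Nonempty (T ≃ₗ[R] LinearMap.ker d) := by
  have := hom_finiteDimensional (K := K) (R := R) P₁
  obtain ⟨n, p, h, he, hh, hp⟩ := h₁
  obtain ⟨m, q, g, he', hg, hq⟩ := h₀
  have key : ∀ x : P₁, (∃ y, i y = nakayamaPairing t p h x) ↔ d x = 0 := by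
    intro x
    rw [hi.exists_eq_iff]
    constructor
    · intro h1
      refine nakayamaPairing_injective H hg hq (LinearMap.ext fun f => ?_)
      rw [nakayamaPairing_naturality H hh hp hg hq, h1, LinearMap.zero_apply]
    · intro h1 f
      rw [← nakayamaPairing_naturality H hh hp hg hq, h1, map_zero, LinearMap.zero_apply]
  choose F hF using fun x : LinearMap.ker d => (key x).2 x.2
  let G : LinearMap.ker d →ₗ[R] T :=
    { toFun := F
      map_add' := fun x y => hi.injective (by rw [map_add, hF, hF, hF, ← map_add]; rfl)
      map_smul' := fun r x => hi.injective (by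
        ext f
        rw [RingHom.id_apply, hi.smul_apply, hF, hF, ← nakayamaPairing_smul]; rfl) }
  refine ⟨(LinearEquiv.ofBijective G ⟨?_, fun y => ?_⟩).symm⟩
  · rw [injective_iff_map_eq_zero]
    intro x hx
    have hx' : F x = 0 := hx
    refine Subtype.ext (nakayamaPairing_injective H hh hp (x := x) ?_)
    rw [← hF, hx', map_zero]
  · obtain ⟨x, hx⟩ := nakayamaPairing_surjective H he hh hp (i y)
    exact ⟨⟨x, (key x).1 ⟨y, hx.symm⟩⟩, hi.injective ((hF _).trans hx)⟩

variable (K) in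
/-- The subspace `Hom_R(P, R) eR` of `Hom_R(P, R)`. -/
def homTrace (e : R) (P : Type u) [AddCommGroup P] [Module R P] : Submodule K (P →ₗ[R] R) :=
  Submodule.span K {g | ∃ r f, LinearMap.toSpanSingleton R R (e * r) ∘ₗ f = g}

theorem comp_mem_homTrace (e r : R) {P : Type u} [AddCommGroup P] [Module R P]
    (f : P →ₗ[R] R) : LinearMap.toSpanSingleton R R (e * r) ∘ₗ f ∈ homTrace K e P :=
  Submodule.subset_span ⟨r, f, rfl⟩

theorem smul_mem_traceSub_of_mem_homTrace {P Q : Type u} [AddCommGroup P] [Module R P]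
    [AddCommGroup Q] [Module R Q] [Module K Q] [IsScalarTower K R Q]
    {f : P →ₗ[R] R} (hf : f ∈ homTrace K e P) (x : P) (q : Q) : f x • q ∈ traceSub e Q := by
  induction hf using Submodule.span_induction with
  | mem f hf =>
    obtain ⟨r, f, rfl⟩ := hf
    simp only [LinearMap.comp_apply, LinearMap.toSpanSingleton_apply, smul_eq_mul]
    rw [← mul_assoc, mul_smul]
    exact smul_mem_traceSub _ _ _
  | zero => simp
  | add f g _ _ hf hg => simpa [add_smul] using add_mem hf hg
  | smul k f _ hf =>
    rw [LinearMap.smul_apply, smul_assoc, ← algebraMap_smul R]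
    exact Submodule.smul_mem _ _ hf

theorem InAdd.mem_homTrace {P : Type u} [AddCommGroup P] [Module R P] (hP : InAdd e P)
    (f : P →ₗ[R] R) : f ∈ homTrace K e P := by
  obtain ⟨n, p, h, he, hh, hp⟩ := hP
  have h1 : f = ∑ i, LinearMap.toSpanSingleton R R (e * f (p i)) ∘ₗ h i := by
    ext x
    conv_lhs => rw [← hp x]
    rw [map_sum, LinearMap.sum_apply]
    refine Finset.sum_congr rfl fun i _ => ?_
    rw [map_smul, ← hh]
    simp [mul_assoc]
  rw [h1]
  exact Submodule.sum_mem _ fun i _ => comp_mem_homTrace _ _ _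

/-- T is dual to the cokernel of Hom(P₀, R) → Hom(P₁, R). Its torsion-freeness says that every map
P₁ → R factors through `d` modulo Hom(P₁, R)eR; a dual basis transfers this to the identity of P₁.
-/
theorem IsNakayamaKernel.exists_sub_mem_traceSub [Module K P₁]
    [IsScalarTower K R P₁] [FiniteDimensional K P₁] (hi : IsNakayamaKernel d i)
    (hT : IsTorsionFree e T) [Module.Projective R P₁] :
    ∃ c : P₀ →ₗ[R] P₁, ∀ x, x - c (d x) ∈ traceSub e P₁ := by
  have key : ∀ h : P₁ →ₗ[R] R, ∃ f : P₀ →ₗ[R] R, h - f ∘ₗ d ∈ homTrace K e P₁ := by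
    intro h
    by_contra! hc
    have h1 : h ∉ homTrace K e P₁ ⊔ LinearMap.range (LinearMap.lcomp K R d) := by
      intro h1
      obtain ⟨a, ha, b, ⟨f, rfl⟩, rfl⟩ := Submodule.mem_sup.1 h1
      refine hc f ?_
      convert ha using 1
      exact add_sub_cancel_right _ _
    -- A separating functional kills the maps factoring through `d`, so it comes from some `y` in T.
    -- It also kills Hom(P₁, R)eR, so `y` is annihilated by eR.
    obtain ⟨l, hl, hN⟩ := Submodule.exists_le_ker_of_notMem h1
    obtain ⟨y, rfl⟩ := (hi.exists_eq_iff l).2 fun f => hN (Submodule.mem_sup_right ⟨f, rfl⟩)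
    refine hl ?_
    rw [hT y fun r => hi.injective ?_, map_zero, LinearMap.zero_apply]
    ext f
    rw [hi.smul_apply, map_zero, LinearMap.zero_apply]
    exact hN (Submodule.mem_sup_left (comp_mem_homTrace _ _ _))
  have : Module.Finite R P₁ := Module.Finite.of_restrictScalars_finite K R P₁
  obtain ⟨n, q, g, hq⟩ := exists_dualBasis (R := R) P₁
  choose f hf using fun j => key (g j)
  refine ⟨Fintype.linearCombination R q ∘ₗ LinearMap.pi f, fun x => ?_⟩
  have h1 : x - (Fintype.linearCombination R q ∘ₗ LinearMap.pi f) (d x) =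
      ∑ j, (g j - f j ∘ₗ d) x • q j := by
    conv_lhs => rw [← hq x]
    simp [Fintype.linearCombination_apply, sub_smul, Finset.sum_sub_distrib, hq]
  rw [h1]
  exact Submodule.sum_mem _ fun j _ => smul_mem_traceSub_of_mem_homTrace (hf j) _ _

/-- Modulo ReQ, any map P₀ → Q can be changed into one that kills the image of `d`. This uses the
existence half of closedness of T. -/
theorem IsNakayamaKernel.exists_comp_eq_zero [IsScalarTower K R T] (he : e * e = e)
    (hi : IsNakayamaKernel d i)
    (hT : IsClosed K e T) (h₁ : InAdd e P₁) {Q : Type u} [AddCommGroup Q] [Module K Q]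
    [Module R Q] [IsScalarTower K R Q] [FiniteDimensional K Q] [Module.Projective R Q]
    (q : P₀ →ₗ[R] Q) : ∃ b : P₀ →ₗ[R] Q, b ∘ₗ d = 0 ∧ ∀ x, q x - b x ∈ traceSub e Q := by
  have key : ∀ h : P₀ →ₗ[R] R, ∃ f : P₀ →ₗ[R] R, f ∘ₗ d = 0 ∧ h - f ∈ homTrace K e P₀ := by
    intro h
    by_contra! hc
    have h1 : h ∘ₗ d ∉ (homTrace K e P₀).map (LinearMap.lcomp K R d) := by
      rintro ⟨a, ha, hd⟩
      refine hc (h - a) ?_ (by simpa using ha)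
      rw [LinearMap.sub_comp, ← hd]
      exact sub_self _
    -- The functional `y` need not come from T, but each of its translates by an element er does.
    -- These translates form an eRe-linear map eR → T, hence come from one `x` in T.
    obtain ⟨y, hy, hN⟩ := Submodule.exists_le_ker_of_notMem h1
    have h2 : ∀ r, ∃ x, i x = y ∘ₗ LinearMap.compRight K (LinearMap.toSpanSingleton R R (e * r)) := by
      intro r
      rw [hi.exists_eq_iff]
      intro f
      exact hN ⟨_, comp_mem_homTrace e r f, rfl⟩
    choose F hF using h2
    have hF' : ∀ r f, i (F r) f = y (LinearMap.toSpanSingleton R R (e * r) ∘ₗ f) :=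
      fun r f => LinearMap.congr_fun (hF r) f
    let G : R →ₗ[K] T :=
      { toFun := F
        map_add' := fun a b => hi.injective (LinearMap.ext fun f => by
          rw [map_add, LinearMap.add_apply, hF', hF', hF', ← map_add]
          congr 1
          ext
          simp [mul_add])
        map_smul' := fun k a => hi.injective (LinearMap.ext fun f => by
          rw [RingHom.id_apply, map_smul, LinearMap.smul_apply, hF', hF', ← map_smul]
          congr 1
          ext
          simp) }
    have he' : ∀ z, e * (e * z) = e * z := fun z => by rw [← mul_assoc, he]
    obtain ⟨x, hx⟩ := hT.exists_eq G fun s r => hi.injective (LinearMap.ext fun f => by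
      change i (F _) f = i (_ • F _) f
      rw [hi.smul_apply, hF', hF']
      congr 1
      ext z
      simp only [LinearMap.comp_apply, LinearMap.toSpanSingleton_apply, smul_eq_mul, mul_assoc,
        he'])
    refine hy ?_
    -- Both sides agree on Hom(P₁, R)eR, which is everything because P₁ lies in add(Re).
    have h3 : y = i x := by
      ext f
      induction h₁.mem_homTrace (K := K) f using Submodule.span_induction with
      | mem f hf =>
        obtain ⟨r, f, rfl⟩ := hf
        rw [← hi.smul_apply, ← hx]
        change _ = i (F _) f
        rw [hF', ← mul_assoc, he]
      | zero => simp
      | add f g _ _ hf hg => rw [map_add, map_add, hf, hg]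
      | smul k f _ hf => rw [map_smul, map_smul, hf]
    rw [h3]
    exact (hi.exists_eq_iff _).1 ⟨x, rfl⟩ h
  have : Module.Finite R Q := Module.Finite.of_restrictScalars_finite K R Q
  obtain ⟨n, p, g, hp⟩ := exists_dualBasis (R := R) Q
  choose f hf hf' using fun j => key (g j ∘ₗ q)
  refine ⟨Fintype.linearCombination R p ∘ₗ LinearMap.pi f, LinearMap.ext fun x => ?_,
    fun x => ?_⟩
  · have h1 : ∀ j, f j (d x) = 0 := fun j => LinearMap.congr_fun (hf j) x
    simp [Fintype.linearCombination_apply, h1]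
  · have h1 : q x - (Fintype.linearCombination R p ∘ₗ LinearMap.pi f) x =
        ∑ j, (g j ∘ₗ q - f j) x • p j := by
      conv_lhs => rw [← hp (q x)]
      simp [Fintype.linearCombination_apply, sub_smul, Finset.sum_sub_distrib]
    rw [h1]
    exact Submodule.sum_mem _ fun j _ => smul_mem_traceSub_of_mem_homTrace (hf' j) _ _

end

end NakayamaKernel

/-! ### Codominant dimension at least two -/

section Coclosed

theorem apply_eq_zero_of_mem_traceSub {K R : Type u} [Field K] [Ring R] {e : R}
    {M : Type u} [AddCommGroup M] [Module K M]
    [Module R M] {f : M →ₗ[K] K} (h : ∀ r m, f ((r * e) • m) = 0) {x : M} (hx : x ∈ traceSub e M) :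
    f x = 0 := by
  let N : Submodule R M :=
    { carrier := {x | ∀ r : R, f (r • x) = 0}
      add_mem' := fun ha hb r => by rw [smul_add, map_add, ha r, hb r, add_zero]
      zero_mem' := fun r => by rw [smul_zero, map_zero]
      smul_mem' := fun s x hx r => by rw [smul_smul, hx] }
  have hN : traceSub e M ≤ N := by
    refine Submodule.span_le.2 ?_
    rintro _ ⟨y, rfl⟩ r
    rw [smul_smul, h]
  simpa using hN hx 1

variable {K R : Type u} [Field K] [Ring R] [Algebra K R]

/-- The condition `IsClosed` for the `K`-dual of `M`. -/
structure IsCoclosed (K : Type u) [Field K] [Algebra K R] (e : R) (M : Type u) [AddCommGroup M]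
    [Module K M] [Module R M] : Prop where
  torsionFree : ∀ f : M →ₗ[K] K, (∀ r m, f ((r * e) • m) = 0) → f = 0
  exists_eq : ∀ f : R →ₗ[K] M →ₗ[K] K,
    (∀ r s m, f (r * (e * s * e)) m = f r ((e * s * e) • m)) →
      ∃ l : M →ₗ[K] K, ∀ r m, f (r * e) m = l ((r * e) • m)

variable {e : R}

theorem traceSub_eq_top_of_functional {M : Type u} [AddCommGroup M] [Module K M] [Module R M]
    [IsScalarTower K R M] (h : ∀ f : M →ₗ[K] K, (∀ r m, f ((r * e) • m) = 0) → f = 0) :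
    traceSub e M = ⊤ := by
  refine Submodule.eq_top_iff'.2 fun x => ?_
  by_contra hx
  obtain ⟨l, hl, hN⟩ := Submodule.exists_functional_of_notMem (K := K) _ hx
  refine hl ?_
  rw [h l fun r m => hN _ (smul_mem_traceSub e r m), LinearMap.zero_apply]

theorem IsProjectiveCover.traceSub_eq_top {P M : Type u} [AddCommGroup P] [Module R P]
    [AddCommGroup M] [Module R M] {f : P →ₗ[R] M} (hf : IsProjectiveCover f)
    (hM : traceSub e M = ⊤) : traceSub e P = ⊤ := by
  refine hf.superfluous _ (Submodule.eq_top_iff'.2 fun x => ?_)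
  have h1 : f x ∈ (traceSub e P).map f := by
    have h2 : f x ∈ traceSub e M := hM ▸ Submodule.mem_top
    refine Submodule.span_le.2 ?_ h2
    rintro _ ⟨y, rfl⟩
    obtain ⟨z, rfl⟩ := hf.surjective y
    exact ⟨e • z, Submodule.subset_span ⟨z, rfl⟩, map_smul f e z⟩
  obtain ⟨y, hy, hyx⟩ := h1
  exact Submodule.mem_sup.2 ⟨y, hy, x - y, by simp [hyx], by simp⟩

variable [FiniteDimensional K R]

/-- A projective cover P of X lies in add(Re) if and only if ReX = X. Thus the claim is that
coclosedness means ReM = M and ReΩ(M) = Ω(M). -/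
theorem FDMod.isCoclosed_iff (he : e * e = e) (M : FDMod K R) :
    IsCoclosed K e M ↔ InAdd e M.projCover ∧ InAdd e M.syzygy.projCover := by
  set π := M.projCoverMap
  have hc := M.isProjectiveCover_projCoverMap
  have hc1 := M.syzygy.isProjectiveCover_projCoverMap
  have := hc.projective
  have := hc1.projective
  constructor
  · intro h
    have h0 := hc.traceSub_eq_top (traceSub_eq_top_of_functional h.torsionFree)
    refine ⟨inAdd_of_traceSub_eq_top K he h0, inAdd_of_traceSub_eq_top K he
      (hc1.traceSub_eq_top (traceSub_eq_top_of_functional (K := K) fun f hf => ?_))⟩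
    let f' : LinearMap.ker π →ₗ[K] K := f
    obtain ⟨l, hl⟩ := ((LinearMap.ker π).subtype.restrictScalars K).exists_leftInverse_of_injective
      (LinearMap.ker_eq_bot.2 Subtype.val_injective)
    obtain ⟨s, hs⟩ := (π.restrictScalars K).exists_rightInverse_of_surjective
      (LinearMap.range_eq_top.2 hc.surjective)
    have hl' : ∀ x : LinearMap.ker π, l x = x := fun x => LinearMap.congr_fun hl x
    have hs' : ∀ x, π (s x) = x := fun x => LinearMap.congr_fun hs x
    -- As `f'` kills Re·Ω(M), the extended functional on `(r * e) • x` depends only on the image of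
    -- `x` in M. This defines the balanced form `F`, and coclosedness turns it into a functional `g`
    -- on M.
    have key : ∀ r x, f' (l ((r * e) • x)) = f' (l ((r * e) • s (π x))) := by
      intro r x
      have h1 : x - s (π x) ∈ LinearMap.ker π := by simp [hs']
      have h2 := hf r ⟨_, h1⟩
      change f' ((r * e) • ⟨_, h1⟩) = 0 at h2
      rw [← hl' ((r * e) • _), Submodule.coe_smul, smul_sub, map_sub, map_sub, sub_eq_zero] at h2
      exact h2
    let F : R →ₗ[K] M →ₗ[K] K := LinearMap.mk₂ K (fun r m => f' (l ((r * e) • s m)))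
      (fun _ _ _ => by simp [add_mul, add_smul]) (fun _ _ _ => by simp)
      (fun _ _ _ => by simp) (fun k r m => by rw [map_smul s, smul_comm (r * e) k]; simp)
    have hF : ∀ r m, F r m = f' (l ((r * e) • s m)) := fun _ _ => rfl
    obtain ⟨g, hg⟩ := h.exists_eq F fun r s' m => by
      rw [hF, hF]
      have h3 := key r ((e * s' * e) • s m)
      rw [map_smul π, hs', smul_smul] at h3
      rw [← h3]
      congr 3
      simp only [mul_assoc, he]
      rw [← mul_assoc e e, he]
    -- The difference vanishes on ReP₀ = P₀. On Ω(M) it restricts to `f'`, which is therefore zero.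
    have h4 : f' ∘ₗ l - g ∘ₗ π.restrictScalars K = 0 := by
      ext x
      refine apply_eq_zero_of_mem_traceSub (e := e) (fun r y => ?_)
        (h0 ▸ Submodule.mem_top : x ∈ traceSub e M.projCover)
      simp only [LinearMap.sub_apply, LinearMap.comp_apply, LinearMap.coe_restrictScalars]
      rw [key, map_smul π, ← hg, hF, mul_assoc, he, sub_self]
    refine LinearMap.ext fun (x : LinearMap.ker π) => ?_
    have h5 := LinearMap.congr_fun h4 x.1
    simp only [LinearMap.sub_apply, LinearMap.comp_apply, LinearMap.coe_restrictScalars, hl',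
      LinearMap.zero_apply, LinearMap.mem_ker.1 x.2, map_zero, sub_zero] at h5
    exact h5
  · rintro ⟨h0, h1⟩
    have ht0 := traceSub_eq_top_of_surjective π hc.surjective h0.traceSub_eq_top
    have ht1 := traceSub_eq_top_of_surjective _ hc1.surjective h1.traceSub_eq_top
    refine ⟨fun f hf => LinearMap.ext fun x =>
      apply_eq_zero_of_mem_traceSub hf (ht0 ▸ Submodule.mem_top), fun f hf => ?_⟩
    obtain ⟨n, p, h, hp, hh, hs⟩ := h0
    obtain ⟨s, hs1⟩ := (π.restrictScalars K).exists_rightInverse_of_surjective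
      (LinearMap.range_eq_top.2 hc.surjective)
    have hs' : ∀ x, π (s x) = x := fun x => LinearMap.congr_fun hs1 x
    -- The functional wanted on M is built on P₀ by the dual basis. It descends because it vanishes
    -- on Re·Ω(M) = Ω(M).
    let l : M.projCover →ₗ[K] K := ∑ i, (f.flip (π (p i))) ∘ₗ (h i).restrictScalars K
    have hl : ∀ x, l x = ∑ i, f (h i x) (π (p i)) := fun x => by
      simp [l, LinearMap.sum_apply]
    have key : ∀ r x, l ((r * e) • x) = f (r * e) (π x) := by
      intro r x
      rw [hl]
      have h2 : ∀ i, f (h i ((r * e) • x)) (π (p i)) = f r ((e * h i x * e) • π (p i)) := by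
        intro i
        rw [← hf, map_smul, smul_eq_mul, mul_assoc, ← hh i x]
        simp only [mul_assoc, he]
      have h3 := hf r 1 (π x)
      rw [mul_one, he] at h3
      rw [h3, ← map_smul]
      conv_rhs => rw [← hs x]
      simp only [h2, ← map_smul, Finset.smul_sum, map_sum]
      refine Finset.sum_congr rfl fun i _ => ?_
      rw [mul_assoc, hh, mul_smul]
    have hker : ∀ x, π x = 0 → l x = 0 := by
      intro x hx
      have h2 : (⟨x, hx⟩ : LinearMap.ker π) ∈ traceSub e (LinearMap.ker π) :=
        Submodule.eq_top_iff'.1 ht1 (show LinearMap.ker π from ⟨x, hx⟩)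
      refine apply_eq_zero_of_mem_traceSub
        (f := l ∘ₗ (LinearMap.ker π).subtype.restrictScalars K) (fun r m => ?_) h2
      have h3 := key r m
      rw [LinearMap.mem_ker.1 m.2, map_zero] at h3
      exact h3
    refine ⟨l ∘ₗ s, fun r m => ?_⟩
    rw [← sub_eq_zero]
    have h2 := hker ((r * e) • s m - s ((r * e) • m)) (by simp [hs'])
    rw [map_sub, key, hs'] at h2
    exact h2

/-- The natural identification of the kernel of the presentation map with `Ω²(M)`. -/
noncomputable def FDMod.kerPresentationMapEquiv (M : FDMod K R) :
    LinearMap.ker M.presentationMap ≃ₗ[R] M.syzygy.syzygy :=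
  LinearEquiv.ofEq _ _ (LinearMap.ker_comp_of_ker_eq_bot _ (Submodule.ker_subtype _))

variable {t : R →ₗ[K] K}

theorem FDMod.nonempty_equiv_of_isCoclosed (H : IsSymmetricIdempotent K e t) (M T : FDMod K R)
    {i : T →ₗ[K] (M.syzygy.projCover →ₗ[R] R) →ₗ[K] K}
    (hi : IsNakayamaKernel M.presentationMap i) (hM : IsCoclosed K e M) :
    Nonempty (T ≃ₗ[R] M.syzygy.syzygy) := by
  obtain ⟨h0, h1⟩ := (M.isCoclosed_iff H.idem).1 hM
  exact (hi.nonempty_equiv_ker H h1 h0).map fun f => f.trans M.kerPresentationMapEquiv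

theorem FDMod.isCoclosed_of_equiv (H : IsSymmetricIdempotent K e t) (hR : IsClosed K e R)
    (M T : FDMod K R) {i : T →ₗ[K] (M.syzygy.projCover →ₗ[R] R) →ₗ[K] K}
    (hi : IsNakayamaKernel M.presentationMap i)
    (hM : ∀ (Q : FDMod K R) (f : Q →ₗ[R] M) (g : M →ₗ[R] Q), (∀ x, g (f x) = x) →
      Module.Projective R Q → traceSub e Q = ⊤)
    (f : T ≃ₗ[R] M.syzygy.syzygy) : IsCoclosed K e M := by
  have hc := M.isProjectiveCover_projCoverMap
  have hc1 := M.syzygy.isProjectiveCover_projCoverMap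
  have hp := hc.projective
  have hp1 := hc1.projective
  have hclosed : IsClosed K e T := by
    refine IsClosed.of_linearEquiv ?_ (f.trans M.kerPresentationMapEquiv.symm)
    exact (hR.of_projective H M.syzygy.projCover).of_exact (hR.of_projective H M.projCover).torsionFree
      (LinearMap.ker M.presentationMap).subtype M.presentationMap Subtype.val_injective
      fun c => ⟨fun h => ⟨⟨c, h⟩, rfl⟩, fun ⟨x, hx⟩ => hx ▸ x.2⟩
  have hrange : ∀ x, M.projCoverMap x = 0 ↔ ∃ y, M.presentationMap y = x := by
    intro x
    constructor
    · intro h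
      obtain ⟨y, hy⟩ := hc1.surjective (⟨x, h⟩ : LinearMap.ker M.projCoverMap)
      exact ⟨y, congrArg Subtype.val hy⟩
    · rintro ⟨y, rfl⟩
      exact Subtype.property (p := fun x => x ∈ LinearMap.ker M.projCoverMap)
        (M.syzygy.projCoverMap y)
  have ht1 : traceSub e M.syzygy.projCover = ⊤ := by
    obtain ⟨c, hcd⟩ := hi.exists_sub_mem_traceSub hclosed.torsionFree
    -- Each x differs from d(c(x)) by an element that `c` sends into ReP₁, and the image of `d` is
    -- superfluous. So `c` maps all of P₀ into ReP₁, and P₁ = ReP₁.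
    have h1 := hc.superfluous ((traceSub e M.syzygy.projCover).comap c)
      (Submodule.eq_top_iff'.2 fun x => Submodule.mem_sup.2
        ⟨x - M.presentationMap (c x), by simpa using hcd (c x),
          M.presentationMap (c x), (hrange _).2 ⟨_, rfl⟩, by simp⟩)
    refine Submodule.eq_top_iff'.2 fun x => ?_
    have h2 : M.presentationMap x ∈ (traceSub e M.syzygy.projCover).comap c :=
      h1 ▸ Submodule.mem_top
    simpa using add_mem (hcd x) h2
  have h1 := inAdd_of_traceSub_eq_top K H.idem ht1
  refine (M.isCoclosed_iff H.idem).2 ⟨inAdd_of_traceSub_eq_top K H.idem ?_, h1⟩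
  -- The obstruction S = P₀/ReP₀ satisfies ReS = 0. The lift of P₀ → S to the projective cover of S
  -- is corrected to a map `b` that kills Ω(M); it is still onto, so the cover of S becomes a direct
  -- summand of M.
  let S : FDMod K R := FDMod.of K R (M.projCover ⧸ traceSub e M.projCover)
  have hcS := S.isProjectiveCover_projCoverMap
  have hpS := hcS.projective
  obtain ⟨q, hq⟩ := Module.projective_lifting_property S.projCoverMap
    (traceSub e M.projCover).mkQ hcS.surjective
  obtain ⟨b, hb, hqb⟩ := hi.exists_comp_eq_zero H.idem hclosed h1 q
  have hS : traceSub e S = ⊥ := traceSub_quotient e M.projCover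
  have hSb : ∀ x, S.projCoverMap (b x) = (traceSub e M.projCover).mkQ x := by
    intro x
    have h2 := map_mem_traceSub e S.projCoverMap (hqb x)
    rw [hS, Submodule.mem_bot, map_sub, sub_eq_zero] at h2
    rw [← h2]
    exact LinearMap.congr_fun hq x
  have hbsurj : Function.Surjective b := by
    rw [← LinearMap.range_eq_top]
    refine hcS.superfluous _ (Submodule.eq_top_iff'.2 fun y => ?_)
    obtain ⟨x, hx⟩ := Submodule.mkQ_surjective _ (S.projCoverMap y)
    exact Submodule.mem_sup.2 ⟨b x, ⟨x, rfl⟩, y - b x,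
      by rw [LinearMap.mem_ker, map_sub, hSb, hx, sub_self], by simp⟩
  have hbker : LinearMap.ker M.projCoverMap ≤ LinearMap.ker b := by
    intro x hx
    obtain ⟨y, rfl⟩ := (hrange x).1 hx
    exact LinearMap.congr_fun hb y
  let b' : M →ₗ[R] S.projCover := (LinearMap.ker M.projCoverMap).liftQ b hbker ∘ₗ
    (M.projCoverMap.quotKerEquivOfSurjective hc.surjective).symm.toLinearMap
  have hb' : ∀ x, b' (M.projCoverMap x) = b x := by
    intro x
    have h2 : (M.projCoverMap.quotKerEquivOfSurjective hc.surjective).symm (M.projCoverMap x) =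
        Submodule.Quotient.mk x := by
      rw [LinearEquiv.symm_apply_eq]
      rfl
    simp only [b', LinearMap.comp_apply, LinearEquiv.coe_coe, h2]
    exact Submodule.liftQ_apply _ _ _
  obtain ⟨s, hs⟩ := Module.projective_lifting_property b' LinearMap.id fun y => by
    obtain ⟨x, rfl⟩ := hbsurj y
    exact ⟨_, hb' x⟩
  have h2 := traceSub_eq_top_of_surjective S.projCoverMap hcS.surjective
    (hM _ s b' (fun x => LinearMap.congr_fun hs x) hpS)
  refine Submodule.eq_top_iff'.2 fun x => ?_
  have h3 : (traceSub e M.projCover).mkQ x ∈ traceSub e (M.projCover ⧸ traceSub e M.projCover) :=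
    (h2 ▸ Submodule.mem_top : (show S from (traceSub e M.projCover).mkQ x) ∈ traceSub e S)
  rw [traceSub_quotient, Submodule.mem_bot, Submodule.mkQ_apply,
    Submodule.Quotient.mk_eq_zero] at h3
  exact h3

end Coclosed

/-! ### Duality -/

section Duality

variable {K R S : Type u} [Field K] [Ring R] [Algebra K R] [Ring S] [Algebra K S]

/-- `E` identifies the `S`-module `D` with the `K`-dual of the `R`-module `M`, along the
anti-isomorphism `ρ : S → R`. -/
structure IsDualPairing (ρ : S ≃ₗ[K] R) {D M : Type u} [AddCommGroup D] [Module K D] [Module S D]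
    [AddCommGroup M] [Module K M] [Module R M] (E : D ≃ₗ[K] (M →ₗ[K] K)) : Prop where
  map_mul : ∀ a b, ρ (a * b) = ρ b * ρ a
  smul_apply : ∀ (s : S) (x : D) (m : M), E (s • x) m = E x (ρ s • m)

namespace IsDualPairing

variable {ρ : S ≃ₗ[K] R} {D M : Type u} [AddCommGroup D] [Module K D] [Module S D]
  [AddCommGroup M] [Module K M] [Module R M] {E : D ≃ₗ[K] (M →ₗ[K] K)}

theorem map_mul_symm (h : IsDualPairing ρ E) (a b : R) :
    ρ.symm (a * b) = ρ.symm b * ρ.symm a := by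
  rw [LinearEquiv.symm_apply_eq, h.map_mul]
  simp

theorem smul_symm_apply (h : IsDualPairing ρ E) (s : S) (f : M →ₗ[K] K) (m : M) :
    E (s • E.symm f) m = f (ρ s • m) := by
  rw [h.smul_apply, LinearEquiv.apply_symm_apply]

theorem isClosed_iff (h : IsDualPairing ρ E) (e : S) : IsClosed K e D ↔ IsCoclosed K (ρ e) M := by
  constructor
  · intro hc
    refine ⟨fun f hf => ?_, fun f hf => ?_⟩
    · refine E.symm.map_eq_zero_iff.1 (hc.torsionFree _ fun r => ?_)
      refine E.injective (LinearMap.ext fun m => ?_)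
      rw [h.smul_symm_apply, h.map_mul, hf, map_zero, LinearMap.zero_apply]
    · obtain ⟨x, hx⟩ := hc.exists_eq (E.symm.toLinearMap ∘ₗ f ∘ₗ ρ.toLinearMap) fun s r =>
        E.injective (LinearMap.ext fun m => by
          simp only [LinearMap.comp_apply, LinearEquiv.coe_coe]
          rw [h.smul_symm_apply, LinearEquiv.apply_symm_apply, h.map_mul, h.map_mul, h.map_mul,
            ← mul_assoc (ρ e), hf])
      refine ⟨E x, fun r m => ?_⟩
      have h1 := LinearMap.congr_fun (congrArg E (hx (ρ.symm r))) m
      simpa [h.smul_apply, h.map_mul] using h1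
  · intro hc
    refine ⟨fun x hx => ?_, fun f hf => ?_⟩
    · refine E.map_eq_zero_iff.1 (hc.torsionFree _ fun r m => ?_)
      have h1 := LinearMap.congr_fun (congrArg E (hx (ρ.symm r))) m
      simpa [h.smul_apply, h.map_mul] using h1
    · obtain ⟨l, hl⟩ := hc.exists_eq (E.toLinearMap ∘ₗ f ∘ₗ ρ.symm.toLinearMap) fun r s m => by
        simp only [LinearMap.comp_apply, LinearEquiv.coe_coe]
        have h1 := hf (ρ.symm s) (ρ.symm r)
        have h2 : ρ.symm (r * (ρ e * s * ρ e)) = e * ρ.symm s * e * ρ.symm r := by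
          rw [h.map_mul_symm, h.map_mul_symm, h.map_mul_symm]
          simp [mul_assoc]
        rw [h2, h1, h.smul_apply, h.map_mul, h.map_mul]
        simp [mul_assoc]
      refine ⟨E.symm l, fun r => E.injective (LinearMap.ext fun m => ?_)⟩
      have h1 := hl (ρ r) m
      rw [h.smul_symm_apply, h.map_mul, ← h1]
      simp [h.map_mul_symm]

/-- With a dual basis of M, a map to D(M) is determined by the functionals evaluating it at the `p
j`. These extend K-linearly and reassemble to an S-linear map. -/
theorem injective (h : IsDualPairing ρ E) [IsScalarTower K R M] [FiniteDimensional K M]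
    [Module.Projective R M] [IsScalarTower K S D] : Module.Injective S D := by
  have : Module.Finite R M := Module.Finite.of_restrictScalars_finite K R M
  obtain ⟨n, p, g, hp⟩ := exists_dualBasis (R := R) M
  refine ⟨fun X Y _ _ _ _ f hf φ => ?_⟩
  let _ : Module K X := Module.compHom X (algebraMap K S)
  let _ : Module K Y := Module.compHom Y (algebraMap K S)
  have : IsScalarTower K S X := ⟨fun k r x => by
    change (k • r) • x = algebraMap K S k • r • x
    rw [Algebra.smul_def, mul_smul]⟩
  have : IsScalarTower K S Y := ⟨fun k r x => by
    change (k • r) • x = algebraMap K S k • r • x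
    rw [Algebra.smul_def, mul_smul]⟩
  obtain ⟨q, hq⟩ := (f.restrictScalars K).exists_leftInverse_of_injective
    (LinearMap.ker_eq_bot.2 hf)
  have hq' : ∀ x, q (f x) = x := fun x => LinearMap.congr_fun hq x
  let G : Y → M →ₗ[K] K := fun y => ∑ j, (LinearMap.applyₗ (p j) ∘ₗ E.toLinearMap ∘ₗ
    φ.restrictScalars K ∘ₗ q) ∘ₗ (LinearMap.toSpanSingleton S Y y).restrictScalars K ∘ₗ
      ρ.symm.toLinearMap ∘ₗ (g j).restrictScalars K
  have hG : ∀ y m, G y m = ∑ j, E (φ (q (ρ.symm (g j m) • y))) (p j) := fun y m => by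
    simp [G, LinearMap.sum_apply]
  refine ⟨{ toFun := fun y => E.symm (G y)
            map_add' := fun x y => E.injective (LinearMap.ext fun m => by
              simp [hG, Finset.sum_add_distrib])
            map_smul' := fun s y => E.injective (LinearMap.ext fun m => by
              rw [RingHom.id_apply, h.smul_symm_apply, LinearEquiv.apply_symm_apply, hG, hG]
              simp [h.map_mul_symm, mul_smul]) }, fun x => E.injective (LinearMap.ext fun m => ?_)⟩
  change E (E.symm (G (f x))) m = _
  rw [LinearEquiv.apply_symm_apply, hG]
  conv_rhs => rw [← hp m, map_sum]
  refine Finset.sum_congr rfl fun j _ => ?_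
  rw [← map_smul, hq', map_smul, h.smul_apply, LinearEquiv.apply_symm_apply]

/-- A basis of D embeds M in a power of D(R). The embedding splits, and reflexivity of R turns the
splitting into a dual basis of D. -/
theorem projective (h : IsDualPairing ρ E) [IsScalarTower K R M] [FiniteDimensional K M]
    [FiniteDimensional K R] [IsScalarTower K S D] (hM : Module.Injective R M) :
    Module.Projective S D := by
  have : FiniteDimensional K D := Module.Finite.equiv E.symm
  let b := Module.finBasis K D
  let j : M →ₗ[R] Fin (Module.finrank K D) → FDMod.Coind K R K :=
    { toFun := fun m i => E (b i) ∘ₗ (LinearMap.toSpanSingleton R M m).restrictScalars K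
      map_add' := fun x y => funext fun i => LinearMap.ext fun r =>
        (congrArg (E (b i)) (smul_add r x y)).trans (map_add (E (b i)) _ _)
      map_smul' := fun s x => funext fun i => LinearMap.ext fun r =>
        congrArg (E (b i)) (mul_smul r s x).symm }
  have hj : ∀ m i r, FDMod.Coind.eval (j m i) r = E (b i) (r • m) := fun _ _ _ => rfl
  obtain ⟨π, hπ⟩ := hM.out j ((injective_iff_map_eq_zero j).2 fun m hm => by
    refine (Module.forall_dual_apply_eq_zero_iff K m).1 fun f => ?_
    rw [← E.apply_symm_apply f, ← b.sum_repr (E.symm f), map_sum, LinearMap.sum_apply]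
    refine Finset.sum_eq_zero fun i _ => ?_
    have h1 := hj m i 1
    rw [hm, one_smul] at h1
    rw [map_smul, LinearMap.smul_apply, ← h1]
    exact smul_zero _) LinearMap.id
  let c : Fin (Module.finrank K D) → D →ₗ[K] R := fun i =>
    (Module.evalEquiv K R).symm.toLinearMap ∘ₗ LinearMap.lcomp K K (π.restrictScalars K ∘ₗ
      LinearMap.single K (fun _ => FDMod.Coind K R K) i) ∘ₗ E.toLinearMap
  have hc : ∀ i x (f : FDMod.Coind K R K), f.eval (c i x) = E x (π (Pi.single i f)) :=
    fun i x f => Module.apply_evalEquiv_symm_apply K R (show R →ₗ[K] K from f) _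
  have hcs : ∀ i s x (f : FDMod.Coind K R K), f.eval (c i (s • x)) = f.eval (c i x * ρ s) := by
    intro i s x f
    rw [hc, h.smul_apply, ← map_smul, ← Pi.single_smul, ← hc, FDMod.Coind.smul_eval]
  refine projective_of_dualBasis b (fun i =>
    { toFun := fun x => ρ.symm (c i x)
      map_add' := fun x y => by rw [map_add, map_add]
      map_smul' := fun s x => by
        rw [LinearEquiv.symm_apply_eq, RingHom.id_apply, smul_eq_mul, h.map_mul,
          LinearEquiv.apply_symm_apply, ← sub_eq_zero]
        refine (Module.forall_dual_apply_eq_zero_iff K _).1 fun f => ?_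
        rw [map_sub, sub_eq_zero]
        exact hcs i s x f }) fun x => E.injective (LinearMap.ext fun m => ?_)
  conv_rhs => rw [← LinearMap.id_apply (R := R) m, ← hπ m, ← Finset.univ_sum_single (j m)]
  rw [map_sum, map_sum, map_sum, LinearMap.sum_apply]
  refine Finset.sum_congr rfl fun i _ => ?_
  rw [← hc, hj, h.smul_apply]
  simp

/-- The dual of a linear map. -/
def dualMap (h : IsDualPairing ρ E) {D' M' : Type u} [AddCommGroup D'] [Module K D'] [Module S D']
    [AddCommGroup M'] [Module K M'] [Module R M'] {E' : D' ≃ₗ[K] (M' →ₗ[K] K)}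
    [IsScalarTower K R M] [IsScalarTower K R M']
    (h' : IsDualPairing ρ E') (f : M →ₗ[R] M') : D' →ₗ[S] D where
  toFun x := E.symm (E' x ∘ₗ f.restrictScalars K)
  map_add' x y := by rw [map_add, LinearMap.add_comp, map_add]
  map_smul' s x := E.injective (LinearMap.ext fun m => by
    simp [h.smul_symm_apply, h'.smul_apply])

theorem dualMap_apply (h : IsDualPairing ρ E) {D' M' : Type u} [AddCommGroup D'] [Module K D']
    [Module S D'] [AddCommGroup M'] [Module K M'] [Module R M'] {E' : D' ≃ₗ[K] (M' →ₗ[K] K)}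
    [IsScalarTower K R M] [IsScalarTower K R M']
    (h' : IsDualPairing ρ E') (f : M →ₗ[R] M') (x : D') (m : M) :
    E (h.dualMap h' f x) m = E' x (f m) := by
  simp [dualMap]

theorem dualMap_dualMap_eq (h : IsDualPairing ρ E) {D' M' : Type u} [AddCommGroup D']
    [Module K D'] [Module S D'] [AddCommGroup M'] [Module K M'] [Module R M']
    {E' : D' ≃ₗ[K] (M' →ₗ[K] K)} [IsScalarTower K R M] [IsScalarTower K R M']
    (h' : IsDualPairing ρ E') (f : M →ₗ[R] M') (g : M' →ₗ[R] M) (hgf : ∀ m, g (f m) = m) (x : D) :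
    h.dualMap h' f (h'.dualMap h g x) = x :=
  E.injective (LinearMap.ext fun m => by rw [dualMap_apply, dualMap_apply, hgf])

/-- The dual of a linear equivalence. -/
def dualEquiv (h : IsDualPairing ρ E) {D' M' : Type u} [AddCommGroup D'] [Module K D']
    [Module S D'] [AddCommGroup M'] [Module K M'] [Module R M'] {E' : D' ≃ₗ[K] (M' →ₗ[K] K)}
    [IsScalarTower K R M] [IsScalarTower K R M']
    (h' : IsDualPairing ρ E') (f : M ≃ₗ[R] M') : D' ≃ₗ[S] D where
  __ := h.dualMap h' f.toLinearMap
  invFun := h'.dualMap h f.symm.toLinearMap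
  left_inv := h'.dualMap_dualMap_eq h f.symm.toLinearMap f.toLinearMap f.apply_symm_apply
  right_inv := h.dualMap_dualMap_eq h' f.toLinearMap f.symm.toLinearMap f.symm_apply_apply

/-- A finite dimensional module is isomorphic to its double dual. -/
noncomputable def doubleDual (h : IsDualPairing ρ E) [FiniteDimensional K M]
    {D' : Type u} [AddCommGroup D'] [Module K D'] [Module R D'] {E' : D' ≃ₗ[K] (D →ₗ[K] K)}
    (h' : IsDualPairing ρ.symm E') : M ≃ₗ[R] D' :=
  LinearEquiv.ofBijective
    { toFun := fun m => E'.symm (LinearMap.applyₗ m ∘ₗ E.toLinearMap)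
      map_add' := fun x y => E'.injective (LinearMap.ext fun m => by simp)
      map_smul' := fun r x => E'.injective (LinearMap.ext fun m => by
        simp [h'.smul_symm_apply, h.smul_apply]) } <| by
    refine ⟨(injective_iff_map_eq_zero _).2 fun m hm => ?_, fun x => ?_⟩
    · refine (Module.forall_dual_apply_eq_zero_iff K m).1 fun f => ?_
      have h1 := LinearMap.congr_fun (E'.symm.map_eq_zero_iff.1 hm) (E.symm f)
      simpa using h1
    · obtain ⟨m, hm⟩ := (Module.evalEquiv K M).surjective (E' x ∘ₗ E.symm.toLinearMap)
      refine ⟨m, E'.injective (LinearMap.ext fun y => ?_)⟩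
      have h1 := LinearMap.congr_fun hm (E y)
      simpa using h1

end IsDualPairing

end Duality

/-! ### Direct summands and uniqueness of projective covers -/

section Transport

variable {R : Type u} [Ring R]

theorem isCompl_range_ker_of_leftInverse {M Q : Type u} [AddCommGroup M] [Module R M]
    [AddCommGroup Q] [Module R Q] (f : Q →ₗ[R] M) (g : M →ₗ[R] Q) (h : ∀ x, g (f x) = x) :
    IsCompl (LinearMap.range f) (LinearMap.ker g) := by
  refine IsCompl.of_eq (eq_bot_iff.2 ?_) (Submodule.eq_top_iff'.2 fun x => ?_)
  · rintro _ ⟨⟨x, rfl⟩, hx⟩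
    have h1 : g (f x) = 0 := hx
    rw [h] at h1
    simp [h1]
  · exact Submodule.mem_sup.2 ⟨f (g x), ⟨_, rfl⟩, x - f (g x), by simp [h], by simp⟩

theorem injective_of_linearEquiv {M N : Type u} [AddCommGroup M] [Module R M] [AddCommGroup N]
    [Module R N] (f : M ≃ₗ[R] N) (hM : Module.Injective R M) : Module.Injective R N :=
  injective_of_retract f.symm.toLinearMap f.toLinearMap f.apply_symm_apply hM

theorem IsProjectiveCover.nonempty_equiv_ker {P Q M N : Type u} [AddCommGroup P] [Module R P]
    [AddCommGroup Q] [Module R Q] [AddCommGroup M] [Module R M] [AddCommGroup N] [Module R N]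
    {f : P →ₗ[R] M} {g : Q →ₗ[R] N} (hf : IsProjectiveCover f) (hg : IsProjectiveCover g)
    (u : M ≃ₗ[R] N) : Nonempty (LinearMap.ker f ≃ₗ[R] LinearMap.ker g) := by
  have := hf.projective
  have := hg.projective
  obtain ⟨k, hk⟩ := Module.projective_lifting_property g (u.toLinearMap ∘ₗ f) hg.surjective
  have hk' : ∀ x, g (k x) = u (f x) := fun x => LinearMap.congr_fun hk x
  have hks : Function.Surjective k := by
    rw [← LinearMap.range_eq_top]
    refine hg.superfluous _ (Submodule.eq_top_iff'.2 fun y => ?_)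
    obtain ⟨x, hx⟩ := hf.surjective (u.symm (g y))
    exact Submodule.mem_sup.2 ⟨k x, ⟨x, rfl⟩, y - k x, by simp [hk', hx], by simp⟩
  obtain ⟨s, hs⟩ := Module.projective_lifting_property k LinearMap.id hks
  have hs' : ∀ x, k (s x) = x := fun x => LinearMap.congr_fun hs x
  have hrange : LinearMap.range s = ⊤ := by
    refine hf.superfluous _ (Submodule.eq_top_iff'.2 fun y => ?_)
    refine Submodule.mem_sup.2 ⟨s (k y), ⟨_, rfl⟩, y - s (k y), ?_, by simp⟩
    rw [LinearMap.mem_ker]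
    refine u.injective ?_
    rw [← hk', map_sub, hs', sub_self, map_zero, map_zero]
  have hki : Function.Injective k := by
    rw [injective_iff_map_eq_zero]
    intro x hx
    obtain ⟨y, rfl⟩ := LinearMap.range_eq_top.1 hrange x
    rw [hs'] at hx
    rw [hx, map_zero]
  let v := LinearEquiv.ofBijective k ⟨hki, hks⟩
  refine ⟨v.ofSubmodules _ _ ?_⟩
  ext y
  rw [Submodule.mem_map]
  constructor
  · rintro ⟨x, hx, rfl⟩
    have h1 : g (k x) = 0 := by rw [hk', LinearMap.mem_ker.1 hx, map_zero]
    exact h1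
  · intro hy
    obtain ⟨x, rfl⟩ := hks y
    refine ⟨x, u.injective ?_, rfl⟩
    rw [← hk', LinearMap.mem_ker.1 hy, map_zero]

end Transport

/-! ### The translates as Nakayama kernels; duality between syzygies and cosyzygies -/

section Translates

variable {K R S : Type u} [Field K] [Ring R] [Algebra K R] [Ring S] [Algebra K S]

theorem IsDualPairing.isNakayamaKernel {ρ : S ≃ₗ[K] R} {T Y : Type u} [AddCommGroup T]
    [Module K T] [Module R T] [AddCommGroup Y] [Module K Y] [Module S Y]
    {E : T ≃ₗ[K] (Y →ₗ[K] K)} (h : IsDualPairing ρ.symm E)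
    {P₁ P₀ : Type u} [AddCommGroup P₁] [Module R P₁] [AddCommGroup P₀]
    [Module R P₀] (d : P₁ →ₗ[R] P₀) (q : (P₁ →ₗ[R] R) →ₗ[K] Y) (hq : Function.Surjective q)
    (hqd : ∀ f, q f = 0 ↔ ∃ g : P₀ →ₗ[R] R, g ∘ₗ d = f)
    (hqs : ∀ (r : R) (f : P₁ →ₗ[R] R),
      ρ.symm r • q f = q (LinearMap.toSpanSingleton R R r ∘ₗ f)) :
    IsNakayamaKernel d (LinearMap.lcomp K K q ∘ₗ E.toLinearMap) where
  injective := (injective_iff_map_eq_zero _).2 fun x hx =>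
    E.map_eq_zero_iff.1 (LinearMap.ext fun y => by
      obtain ⟨f, rfl⟩ := hq y
      exact LinearMap.congr_fun hx f)
  exists_eq_iff l := by
    constructor
    · rintro ⟨x, rfl⟩ f
      have h1 : q (f ∘ₗ d) = 0 := (hqd _).2 ⟨f, rfl⟩
      change E x (q (f ∘ₗ d)) = 0
      rw [h1, map_zero]
    · intro hl
      obtain ⟨s, hs⟩ := q.exists_rightInverse_of_surjective (LinearMap.range_eq_top.2 hq)
      refine ⟨E.symm (l ∘ₗ s), LinearMap.ext fun f => ?_⟩
      change E (E.symm (l ∘ₗ s)) (q f) = l f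
      rw [LinearEquiv.apply_symm_apply, LinearMap.comp_apply, ← sub_eq_zero, ← map_sub]
      obtain ⟨g, hg⟩ := (hqd (s (q f) - f)).1 (by
        rw [map_sub, sub_eq_zero]
        exact LinearMap.congr_fun hs (q f))
      rw [← hg, hl]
  smul_apply r x f := by
    change E (r • x) (q f) = E x (q _)
    rw [h.smul_apply, hqs]

variable {A : Type u} [Ring A] [Algebra K A]

/-- The algebra `A` as a right module over itself. -/
def opSelfEquiv (A : Type u) [Ring A] : A ≃ₗ[Aᵐᵒᵖ] Aᵐᵒᵖ where
  toFun := op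
  invFun := unop
  left_inv _ := rfl
  right_inv _ := rfl
  map_add' _ _ := rfl
  map_smul' _ _ := rfl

namespace FDMod

/-- The elements of `D(M)` as functionals on `M`. -/
def dualOfLeftEquiv (M : FDMod K A) : M.dualOfLeft ≃ₗ[K] (M →ₗ[K] K) :=
  LinearEquiv.refl K (M →ₗ[K] K)

/-- The elements of `D(M)` as functionals on `M`. -/
def dualOfRightEquiv (M : FDMod K Aᵐᵒᵖ) : M.dualOfRight ≃ₗ[K] (M →ₗ[K] K) :=
  LinearEquiv.refl K (M →ₗ[K] K)

theorem isDualPairing_dualOfLeft (M : FDMod K A) :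
    IsDualPairing (opLinearEquiv K : A ≃ₗ[K] Aᵐᵒᵖ).symm M.dualOfLeftEquiv where
  map_mul _ _ := rfl
  smul_apply _ _ _ := rfl

theorem isDualPairing_dualOfRight (M : FDMod K Aᵐᵒᵖ) :
    IsDualPairing (opLinearEquiv K : A ≃ₗ[K] Aᵐᵒᵖ) M.dualOfRightEquiv where
  map_mul _ _ := rfl
  smul_apply _ _ _ := rfl

variable [FiniteDimensional K A]

theorem exists_isNakayamaKernel_tau (M : FDMod K Aᵐᵒᵖ) :
    ∃ i : M.tau →ₗ[K] (M.syzygy.projCover →ₗ[Aᵐᵒᵖ] Aᵐᵒᵖ) →ₗ[K] K,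
      IsNakayamaKernel M.presentationMap i := by
  let N := LinearMap.range (LinearMap.lcomp A A M.presentationMap)
  -- The transpose uses maps into A as a right module, the Nakayama kernel maps into the regular
  -- left `Aᵐᵒᵖ`-module; `opSelfEquiv` identifies them.
  let q : (M.syzygy.projCover →ₗ[Aᵐᵒᵖ] Aᵐᵒᵖ) →ₗ[K] M.transposeOfRight :=
    { toFun := fun f => N.mkQ ((opSelfEquiv A).symm.toLinearMap ∘ₗ f)
      map_add' := fun f g => by rw [LinearMap.comp_add, map_add]; rfl
      map_smul' := fun k f => rfl }
  refine ⟨_, M.transposeOfRight.isDualPairing_dualOfLeft.isNakayamaKernel M.presentationMap q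
    (fun y => ?_) (fun f => ?_) fun r f => ?_⟩
  · obtain ⟨g, rfl⟩ := Submodule.mkQ_surjective N y
    exact ⟨(opSelfEquiv A).toLinearMap ∘ₗ g, rfl⟩
  · refine (Submodule.Quotient.mk_eq_zero N).trans ⟨?_, ?_⟩
    · rintro ⟨g, hg⟩
      exact ⟨(opSelfEquiv A).toLinearMap ∘ₗ g,
        LinearMap.ext fun x => congrArg op (LinearMap.congr_fun hg x)⟩
    · rintro ⟨g, rfl⟩
      exact ⟨(opSelfEquiv A).symm.toLinearMap ∘ₗ g, rfl⟩
  · rfl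

theorem exists_isNakayamaKernel_transposeOfLeft (M : FDMod K A) :
    ∃ i : M.transposeOfLeft.dualOfRight →ₗ[K] (M.syzygy.projCover →ₗ[A] A) →ₗ[K] K,
      IsNakayamaKernel M.presentationMap i := by
  let N := LinearMap.range (LinearMap.lcomp Aᵐᵒᵖ A M.presentationMap)
  let q : (M.syzygy.projCover →ₗ[A] A) →ₗ[K] M.transposeOfLeft := N.mkQ.restrictScalars K
  exact ⟨_, IsDualPairing.isNakayamaKernel (ρ := (opLinearEquiv K : A ≃ₗ[K] Aᵐᵒᵖ).symm)
    M.transposeOfLeft.isDualPairing_dualOfRight M.presentationMap q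
    (Submodule.mkQ_surjective N) (fun f => (Submodule.Quotient.mk_eq_zero N).trans Iff.rfl)
    fun r f => rfl⟩

/-- Taking orthogonals turns a submodule N of D(I) that supplements the kernel into a submodule of I
meeting M trivially. Essentiality makes it zero, so N is everything. -/
theorem isProjectiveCover_dual_injHullMap (M : FDMod K Aᵐᵒᵖ) :
    IsProjectiveCover (M.isDualPairing_dualOfRight.dualMap
      M.injHull.isDualPairing_dualOfRight M.injHullMap) := by
  set h := M.isDualPairing_dualOfRight
  set h' := M.injHull.isDualPairing_dualOfRight
  have hM := M.isInjectiveHull_injHullMap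
  refine ⟨h'.projective hM.injective, fun x => ?_, fun N hN => ?_⟩
  · obtain ⟨q, hq⟩ := (M.injHullMap.restrictScalars K).exists_leftInverse_of_injective
      (LinearMap.ker_eq_bot.2 hM.injective_map)
    refine ⟨M.injHull.dualOfRightEquiv.symm (M.dualOfRightEquiv x ∘ₗ q),
      M.dualOfRightEquiv.injective (LinearMap.ext fun m => ?_)⟩
    rw [h.dualMap_apply, LinearEquiv.apply_symm_apply]
    exact congrArg (M.dualOfRightEquiv x) (LinearMap.congr_fun hq m)
  · let E := M.injHull.dualOfRightEquiv
    let N' : Submodule Aᵐᵒᵖ M.injHull :=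
      { carrier := {x | ∀ f ∈ N, E f x = 0}
        add_mem' := fun ha hb f hf => by rw [map_add, ha f hf, hb f hf, add_zero]
        zero_mem' := fun f _ => map_zero _
        smul_mem' := fun a x hx f hf => hx (a.unop • f) (N.smul_mem _ hf) }
    have hN' : N' = ⊥ := by
      refine hM.essential _ (eq_bot_iff.2 ?_)
      rintro _ ⟨hx, m, rfl⟩
      refine (Module.forall_dual_apply_eq_zero_iff K (M.injHullMap m)).1 fun l => ?_
      obtain ⟨f, hf, g, hg, hfg⟩ := Submodule.mem_sup.1
        (hN ▸ Submodule.mem_top : E.symm l ∈ N ⊔ _)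
      have h1 := h.dualMap_apply h' M.injHullMap g m
      rw [LinearMap.mem_ker.1 hg, map_zero, LinearMap.zero_apply] at h1
      rw [← E.apply_symm_apply l, ← hfg, map_add, LinearMap.add_apply, hx f hf]
      exact (zero_add _).trans h1.symm
    refine Submodule.eq_top_iff'.2 fun f => ?_
    by_contra hf
    obtain ⟨l, hl, hlN⟩ := Submodule.exists_functional_of_notMem (K := K) N hf
    let x := (Module.evalEquiv K M.injHull).symm (l ∘ₗ E.symm.toLinearMap)
    have hx : ∀ f, E f x = l f := fun f =>
      (Module.apply_evalEquiv_symm_apply K M.injHull (E f) _).trans (by simp)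
    have h0 : x ∈ N' := fun f hf => by rw [hx, hlN f hf]
    rw [hN', Submodule.mem_bot] at h0
    rw [← hx, h0, map_zero] at hl
    exact hl rfl

theorem nonempty_dualOfRight_cosyzygy_equiv (M : FDMod K Aᵐᵒᵖ) :
    Nonempty (M.cosyzygy.dualOfRight ≃ₗ[A] M.dualOfRight.syzygy) := by
  set h := M.isDualPairing_dualOfRight
  set h' := M.injHull.isDualPairing_dualOfRight
  set h'' := M.cosyzygy.isDualPairing_dualOfRight
  let N := LinearMap.range M.injHullMap
  let π : M.injHull →ₗ[Aᵐᵒᵖ] M.cosyzygy := N.mkQ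
  have hπ : Function.Surjective π := Submodule.mkQ_surjective N
  obtain ⟨s, hs⟩ := (π.restrictScalars K).exists_rightInverse_of_surjective
    (LinearMap.range_eq_top.2 hπ)
  obtain ⟨u⟩ := (M.isProjectiveCover_dual_injHullMap).nonempty_equiv_ker
    M.dualOfRight.isProjectiveCover_projCoverMap (LinearEquiv.refl A _)
  let v : M.cosyzygy.dualOfRight →ₗ[A] LinearMap.ker (h.dualMap h' M.injHullMap) :=
    (h'.dualMap h'' π).codRestrict _ fun x =>
      M.dualOfRightEquiv.injective (LinearMap.ext fun m => by
        rw [h.dualMap_apply, h'.dualMap_apply, map_zero]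
        have h1 : π (M.injHullMap m) = 0 := (Submodule.Quotient.mk_eq_zero N).2 ⟨m, rfl⟩
        rw [h1, map_zero, LinearMap.zero_apply])
  have hv : ∀ x m, M.injHull.dualOfRightEquiv (v x).1 m =
      M.cosyzygy.dualOfRightEquiv x (π m) := fun x m => h'.dualMap_apply h'' π x m
  refine ⟨(LinearEquiv.ofBijective v ⟨?_, fun y => ?_⟩).trans u⟩
  · refine (injective_iff_map_eq_zero _).2 fun x hx => ?_
    refine M.cosyzygy.dualOfRightEquiv.map_eq_zero_iff.1 (LinearMap.ext fun m => ?_)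
    obtain ⟨m, rfl⟩ := hπ m
    rw [← hv, hx]
    rfl
  · refine ⟨M.cosyzygy.dualOfRightEquiv.symm (M.injHull.dualOfRightEquiv y.1 ∘ₗ s),
      Subtype.ext (M.injHull.dualOfRightEquiv.injective (LinearMap.ext fun m => ?_))⟩
    rw [hv, LinearEquiv.apply_symm_apply, LinearMap.comp_apply, ← sub_eq_zero, ← map_sub]
    have h1 : s (π m) - m ∈ N := by
      refine (Submodule.Quotient.mk_eq_zero N).1 ?_
      change π (s (π m) - m) = 0
      rw [map_sub, sub_eq_zero]
      exact LinearMap.congr_fun hs (π m)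
    obtain ⟨z, hz⟩ := h1
    rw [← hz, ← h.dualMap_apply h' M.injHullMap, LinearMap.mem_ker.1 y.2, map_zero,
      LinearMap.zero_apply]

theorem nonempty_syzygy_equiv {R : Type u} [Ring R] [Algebra K R] [FiniteDimensional K R]
    {M N : FDMod K R} (f : M ≃ₗ[R] N) : Nonempty (M.syzygy ≃ₗ[R] N.syzygy) :=
  M.isProjectiveCover_projCoverMap.nonempty_equiv_ker N.isProjectiveCover_projCoverMap f

/-- D is a duality that carries Ω⁻²(M) to Ω²(D(M)) and τ⁻¹(M) = Tr D(M) to D Tr D(M). -/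
theorem nonempty_tauInv_equiv_iff (M : FDMod K Aᵐᵒᵖ) :
    Nonempty (M.tauInv ≃ₗ[Aᵐᵒᵖ] M.cosyzygy.cosyzygy) ↔
      Nonempty (M.dualOfRight.transposeOfLeft.dualOfRight ≃ₗ[A]
        M.dualOfRight.syzygy.syzygy) := by
  obtain ⟨u⟩ := M.cosyzygy.nonempty_dualOfRight_cosyzygy_equiv
  obtain ⟨v⟩ := M.nonempty_dualOfRight_cosyzygy_equiv
  obtain ⟨w⟩ := nonempty_syzygy_equiv v
  let z := u.trans w
  have h := M.cosyzygy.cosyzygy.isDualPairing_dualOfRight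
  have h' := M.tauInv.isDualPairing_dualOfRight
  constructor
  · rintro ⟨f⟩
    exact ⟨(h.dualEquiv h' f.symm).trans z⟩
  · rintro ⟨f⟩
    let g : M.tauInv.dualOfRight ≃ₗ[A] M.cosyzygy.cosyzygy.dualOfRight := f.trans z.symm
    exact ⟨((h'.doubleDual M.tauInv.dualOfRight.isDualPairing_dualOfLeft).trans
      (isDualPairing_dualOfLeft _ |>.dualEquiv (isDualPairing_dualOfLeft _) g.symm)).trans
      (h.doubleDual (isDualPairing_dualOfLeft _)).symm⟩

end FDMod

end Translates

/-! ### The symmetrizing form of a gendo-symmetric algebra -/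

section GendoSymmetric

variable {K A : Type u} [Field K] [Ring A] [Algebra K A] [FiniteDimensional K A]

/-- The form is the functional on Ae corresponding to e in eA, extended to A by a ↦ ae. A-linearity
of `φ` makes the pairing perfect, and compatibility with eAe makes it symmetric. -/
theorem exists_isSymmetricIdempotent {e : A} (he : e * e = e)
    (hf : FaithfulSMul Aᵐᵒᵖ (rightIdeal e)) (hD : DualIsoAsBimodule K e) :
    ∃ t : A →ₗ[K] K, IsSymmetricIdempotent K e t := by
  obtain ⟨φ, hφ⟩ := hD
  let E := (FDMod.of K A (leftIdeal e)).dualOfLeftEquiv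
  have hE := (FDMod.of K A (leftIdeal e)).isDualPairing_dualOfLeft
  let l : A → leftIdeal e := fun a => ⟨a * e, a, rfl⟩
  let r : A → rightIdeal e := fun a => ⟨e * a, op a, rfl⟩
  have hl : ∀ y : leftIdeal e, ∃ a, l a = y := by
    rintro ⟨_, a, rfl⟩
    exact ⟨a, rfl⟩
  have hr : ∀ x : rightIdeal e, ∃ a, r a = x := by
    rintro ⟨_, a, rfl⟩
    exact ⟨a.unop, rfl⟩
  have hle : ∀ a, l (a * e) = l a := fun a => Subtype.ext (by simp [l, mul_assoc, he])
  have hra : ∀ a b, op b • r a = r (a * b) := fun a b => Subtype.ext (by simp [r, mul_assoc])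
  let L : A →ₗ[K] leftIdeal e :=
    { toFun := l
      map_add' := fun a b => Subtype.ext (add_mul a b e)
      map_smul' := fun k a => Subtype.ext (smul_mul_assoc k a e) }
  let t : A →ₗ[K] K := E (φ.symm (r 1)) ∘ₗ L
  have ht : ∀ a b, t (a * b) = E (φ.symm (r a)) (l b) := by
    intro a b
    have h1 := hra 1 a
    rw [one_mul] at h1
    rw [← h1, map_smul, hE.smul_apply]
    exact congrArg (E (φ.symm (r 1))) (Subtype.ext (mul_assoc a b e))
  have hc : ∀ c x y, E (φ.symm (r (e * c * e * x))) (l y) = E (φ.symm (r x)) (l (y * (e * c * e))) := by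
    intro c x y
    have h1 := hφ c (E (φ.symm (r x)))
    have h2 : φ.symm (r (e * c * e * x)) = E.symm (E (φ.symm (r x)) ∘ₗ mulRightCorner K e c) := by
      rw [LinearEquiv.symm_apply_eq]
      refine Subtype.ext (Eq.trans ?_ h1.symm)
      have h3 : φ (φ.symm (r x)) = r x := φ.apply_symm_apply _
      refine Eq.trans ?_ (congrArg (fun z : rightIdeal e => e * c * e * (z : A)) h3.symm)
      simp only [r, ← mul_assoc, he]
      simp only [mul_assoc]
      rw [← mul_assoc e e x, he]
    rw [h2, LinearEquiv.apply_symm_apply]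
    refine congrArg (E (φ.symm (r x))) (Subtype.ext ?_)
    change y * e * (e * c * e) = y * (e * c * e) * e
    simp only [mul_assoc, he]
    rw [← mul_assoc e e, he]
  have hright : ∀ a, t (a * e) = t a := fun a => congrArg (E (φ.symm (r 1))) (hle a)
  have hleft : ∀ a, t (e * a) = t a := fun a => by
    have h1 : r e = r 1 := Subtype.ext (by simp [r, he])
    rw [ht, h1, ← ht, one_mul]
  refine ⟨t, he, hleft, hright, fun a b => ?_, fun x hx => ?_, fun y hy => ?_, fun a ha => ?_⟩
  · have h1 := hc a 1 b
    rw [mul_one, ← ht, ← ht, one_mul] at h1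
    rw [← hleft, ← hright (b * e * a)]
    simpa only [mul_assoc] using h1
  · have h1 : φ.symm (r x) = 0 := E.map_eq_zero_iff.1 (LinearMap.ext fun y => by
      obtain ⟨y, rfl⟩ := hl y
      rw [← ht, hx, LinearMap.zero_apply])
    rw [LinearEquiv.map_eq_zero_iff] at h1
    exact congrArg Subtype.val h1
  · have h1 : l y = 0 := (Module.forall_dual_apply_eq_zero_iff K (l y)).1 fun f => by
      obtain ⟨x, hx⟩ := hr (φ (E.symm f))
      have h2 := ht x y
      rw [hx, LinearEquiv.symm_apply_apply, LinearEquiv.apply_symm_apply, hy] at h2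
      exact h2.symm
    exact congrArg Subtype.val h1
  · refine op_injective (hf.eq_of_smul_eq_smul fun x => ?_)
    obtain ⟨x, rfl⟩ := hr x
    exact Subtype.ext (by simpa [r] using ha x)

/-- The double centralizer property of `eA` passes to `Ae`. -/
theorem IsSymmetricIdempotent.isClosed_self_of_op {e : A} {t : A →ₗ[K] K}
    (H : IsSymmetricIdempotent K e t) (h : IsClosed K (MulOpposite.op e) A) : IsClosed K e A := by
  refine ⟨fun a ha => H.faithful a ha, fun ψ hψ => ?_⟩
  have hψ1 : ∀ x, ψ (e * x) = e * ψ x := fun x => by simpa [H.idem] using hψ 1 x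
  -- The adjoint φ of ψ under the perfect pairing, t(x φ(r)) = t(ψ(x) r), is a right eAe-linear
  -- endomorphism of Ae. It is left multiplication by some a, so ψ is right multiplication by a.
  let l : A →ₗ[K] A →ₗ[K] K := LinearMap.mk₂ K (fun r x => t (ψ x * r))
    (by simp [mul_add]) (by simp) (by simp [add_mul]) (by simp)
  have hl : ∀ r x, t (x * H.rep (l r)) = t (ψ x * r) := fun r x => by
    rw [H.trace_mul_rep]
    change t (ψ (e * x) * r) = _
    rw [hψ1, mul_assoc, H.left]
  let φ : A →ₗ[K] A :=
    { toFun := fun r => H.rep (l r)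
      map_add' := fun a b => H.ext_right (H.rep_mul _)
        (by rw [add_mul, H.rep_mul, H.rep_mul]) fun x => by
          rw [hl, mul_add x, map_add t, hl, hl, mul_add, map_add]
      map_smul' := fun k a => H.ext_right (H.rep_mul _)
        (by rw [RingHom.id_apply, smul_mul_assoc, H.rep_mul]) fun x => by
          rw [RingHom.id_apply, hl, mul_smul_comm, mul_smul_comm, map_smul t, map_smul t, hl] }
  have hφ : ∀ r x, t (x * φ r) = t (ψ x * r) := hl
  have hφe : ∀ r, φ r * e = φ r := fun r => H.rep_mul _
  have hφc : ∀ r s, φ (r * (e * s * e)) = φ r * (e * s * e) := fun r s => by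
    refine H.ext_right (hφe _) (by simp only [mul_assoc, H.idem]) fun x => ?_
    have h1 : e * (s * e * x) = e * s * e * x := by simp only [mul_assoc]
    symm
    calc t (x * (φ r * (e * s * e))) = t (x * φ r * e * s * e) := by simp only [mul_assoc]
      _ = t (s * e * x * φ r) := by rw [H.right, H.symm, ← mul_assoc]
      _ = t (e * s * e * ψ x * r) := by
        rw [hφ, ← H.left, ← mul_assoc, ← hψ1, h1, hψ, smul_eq_mul]
      _ = t (s * e * (ψ x * r)) := by rw [← H.left (s * e * _)]; simp only [mul_assoc]
      _ = t (ψ x * (r * (e * s * e))) := by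
        rw [H.symm, ← H.right]; simp only [mul_assoc]
      _ = t (x * φ (r * (e * s * e))) := (hφ _ _).symm
  obtain ⟨a, ha⟩ := h.exists_eq (φ ∘ₗ (opLinearEquiv K).symm.toLinearMap) fun s r => by
    simpa [mul_assoc] using hφc r.unop s.unop
  have ha' : ∀ r, φ (r * e) = a * (r * e) := fun r => ha (MulOpposite.op r)
  refine ⟨a, fun x => ?_⟩
  rw [hψ1]
  refine H.ext_left (by rw [← mul_assoc, H.idem]) (by simp [← mul_assoc, H.idem]) fun r => ?_
  calc t (e * ψ x * r) = t (ψ x * (r * e)) := by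
        rw [mul_assoc, H.left, ← H.right, mul_assoc]
    _ = t (x * (a * (r * e))) := by rw [← hφ, ha']
    _ = t (e * x * a * r) := by
        rw [← H.left, ← H.right (e * x * a * r)]; simp only [mul_assoc]

end GendoSymmetric

end GendoSymm

/-! ### The proposition -/

open GendoSymm MulOpposite in
theorem mainTheorem10 {K : Type u} {A : Type u} [Field K] [Ring A] [Algebra K A]
    [FiniteDimensional K A] (hA : GendoSymm.IsGendoSymmetric K A)
    (M : GendoSymm.FDMod K Aᵐᵒᵖ) :
    ((2 ≤ M.codomDim → Nonempty (M.tau ≃ₗ[Aᵐᵒᵖ] M.syzygy.syzygy)) ∧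
      ((∀ N L : Submodule Aᵐᵒᵖ M, IsCompl N L →
          Module.Projective Aᵐᵒᵖ N → Module.Injective Aᵐᵒᵖ N) →
        (2 ≤ M.codomDim ↔ Nonempty (M.tau ≃ₗ[Aᵐᵒᵖ] M.syzygy.syzygy)))) ∧
    ((2 ≤ M.domDim → Nonempty (M.tauInv ≃ₗ[Aᵐᵒᵖ] M.cosyzygy.cosyzygy)) ∧
      ((∀ N L : Submodule Aᵐᵒᵖ M, IsCompl N L →
          Module.Injective Aᵐᵒᵖ N → Module.Projective Aᵐᵒᵖ N) →
        (2 ≤ M.domDim ↔ Nonempty (M.tauInv ≃ₗ[Aᵐᵒᵖ] M.cosyzygy.cosyzygy)))) := by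
  obtain ⟨hdom, e, he, hD⟩ := hA
  obtain ⟨t, H⟩ := exists_isSymmetricIdempotent he.idempotent.eq he.faithful hD
  have hA' : IsClosed K (op e) A := (FDMod.two_le_domDim_iff_isClosed H.op _).1 hdom
  have hR : IsClosed K (op e) Aᵐᵒᵖ := hA'.of_linearEquiv (opSelfEquiv A).symm
  have hL : IsClosed K e A := H.isClosed_self_of_op hA'
  constructor
  · obtain ⟨i, hi⟩ := M.exists_isNakayamaKernel_tau
    have h1 : 2 ≤ M.codomDim ↔ IsCoclosed K (op e) M :=
      (FDMod.two_le_domDim_iff_isClosed H _).trans (M.isDualPairing_dualOfRight.isClosed_iff e)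
    rw [h1]
    have h2 := M.nonempty_equiv_of_isCoclosed H.op M.tau hi
    refine ⟨h2, fun hM => ⟨h2, fun ⟨f⟩ => M.isCoclosed_of_equiv H.op hR M.tau hi ?_ f⟩⟩
    intro Q a b hab hQ
    have u := LinearEquiv.ofInjective a (Function.LeftInverse.injective hab)
    have hI := injective_of_linearEquiv u.symm (hM _ _ (isCompl_range_ker_of_leftInverse a b hab)
      (Module.Projective.of_equiv u))
    have : Module.Finite Aᵐᵒᵖ Q := Module.Finite.of_restrictScalars_finite K _ _
    -- A projective summand is torsion-free, and it is injective by hypothesis, so it lies in add of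
    -- the cyclic module at `op e`.
    exact (inAdd_of_injective H.op (isTorsionFree_of_projective H.op Q) hI).traceSub_eq_top
  · rw [M.nonempty_tauInv_equiv_iff]
    set N := M.dualOfRight with hN
    let w := M.isDualPairing_dualOfRight.doubleDual N.isDualPairing_dualOfLeft
    obtain ⟨i, hi⟩ := N.exists_isNakayamaKernel_transposeOfLeft
    have h1 : 2 ≤ M.domDim ↔ IsCoclosed K e N :=
      ((FDMod.two_le_domDim_iff_isClosed H.op _).trans
        ⟨fun h => h.of_linearEquiv w.symm, fun h => h.of_linearEquiv w⟩).trans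
        (N.isDualPairing_dualOfLeft.isClosed_iff (op e))
    rw [h1]
    have h2 := N.nonempty_equiv_of_isCoclosed H N.transposeOfLeft.dualOfRight hi
    refine ⟨h2, fun hM => ⟨h2, fun ⟨f⟩ => N.isCoclosed_of_equiv H hL _ hi ?_ f⟩⟩
    intro Q a b hab hQ
    have hQN := Q.isDualPairing_dualOfLeft
    have hNN := N.isDualPairing_dualOfLeft
    -- A projective summand Q of D(M) dualizes to an injective summand D(Q) of M. By hypothesis D(Q)
    -- is projective, hence torsion-free, which says AeQ = Q.
    let a' : Q.dualOfLeft →ₗ[Aᵐᵒᵖ] M := w.symm.toLinearMap ∘ₗ hNN.dualMap hQN b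
    let b' : M →ₗ[Aᵐᵒᵖ] Q.dualOfLeft := hQN.dualMap hNN a ∘ₗ w.toLinearMap
    have hab' : ∀ x, b' (a' x) = x := fun x => by
      simp only [a', b', LinearMap.comp_apply, LinearEquiv.coe_coe, LinearEquiv.apply_symm_apply]
      exact hQN.dualMap_dualMap_eq hNN a b hab x
    have u := LinearEquiv.ofInjective a' (Function.LeftInverse.injective hab')
    have hP := hM _ _ (isCompl_range_ker_of_leftInverse a' b' hab')
      (injective_of_linearEquiv u hQN.injective)
    have hP' := Module.Projective.of_equiv u.symm
    have : Module.Finite Aᵐᵒᵖ Q.dualOfLeft := Module.Finite.of_restrictScalars_finite K _ _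
    have hT := isTorsionFree_of_projective H.op Q.dualOfLeft
    exact traceSub_eq_top_of_functional (K := K) fun f hf => hT f fun r => LinearMap.ext fun m => hf r.unop m
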